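/- **Darboux theorem for symplectic orbifolds.** *Definitions.* Let $X$ be a Hausdorff, second-countable space. An orbifold chart of dimension $m$ on $X$ is a tuple $(U,V,\phi,\Gamma)$, where $U\subset\mathbb R^m$ is open, $\Gamma$ is a finite group of diffeomorphisms of $U$ which acts effectively on each connected component of $U$ (for connected $U$ this is automatic), $V\subset X$ is open, and $\phi:U\to V$ is a $\Gamma$-invariant map inducing a homeomorphism $U/\Gamma\cong V$. An embedding of a chart $(U_\delta,V_\delta,\phi_\delta,\Gamma_\delta)$ into a chart $(U_\alpha,V_\alpha,\phi_\alpha,\Gamma_\alpha)$ is a group monomorphism $\rho:\Gamma_\delta\to\Gamma_\alpha$ together with a smooth open embedding $\imath:U_\delta\to U_\alpha$ such that $\imath(\gamma x)=\rho(\gamma)\,\imath(x)$ and $\phi_\alpha\circ\imath=\phi_\delta$. An orbifold structure on $X$ is an atlas of charts $(U_\alpha,V_\alpha,\phi_\alpha,\Gamma_\alpha)$ whose $V_\alpha$ cover $X$ and such that for all $\alpha,\beta$ and $x\in V_\alpha\cap V_\beta$ there is a chart of the atlas with $x\in V_\delta\subset V_\alpha\cap V_\beta$ which embeds into the charts $\alpha$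 and $\beta$. An orbifold chart of $X$ is a chart which is compatible with all charts of the atlas: around every common point there is a chart that embeds into both. An orbifold $k$-form $\omega$ is a family of smooth $\Gamma_\alpha$-invariant $k$-forms $\omega_\alpha$ on $U_\alpha$ which agree under changes of charts, i.e. $\imath^*\omega_\alpha=\jmath^*\omega_\beta$ for all embeddings $\imath,\jmath$ of a chart $\delta$ of the atlas into the charts $\alpha$ and $\beta$. It has the expression $\eta$ in an orbifold chart $(U,V,\phi,\Gamma)$ of $X$ if $\eta$ is a form on $U$ with $\imath^*\eta=\jmath^*\omega_\alpha$ for all embeddings $\imath,\jmath$ of any chart into $(U,V,\phi,\Gamma)$ and into a chart $\alpha$ of the atlas. A symplectic orbifold of dimension $2n$ is a $2n$-dimensional orbifold $X$ with an orbifold $2$-form $\omega$ which is closed and nondegenerate (each $d\omega_\alpha=0$ and each $\omega_\alpha$ is nondegenerate at every point of $U_\alpha$). *Statement.* Let $(X,\omega)$ be a symplectic orbifold of dimension $2n$ and let $x_0\in X$. Then there is an orbifold chart $(U,V,\phi,\Gamma)$ of $X$ around $x_0$, with $0\in U\subset\mathbb R^{2n}$ and $\phi(0)=x_0$, such that in the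 coordinates $(x_1,y_1,\dots,x_n,y_n)$ of $\mathbb R^{2n}$ the form $\omega$ has the expression $$\omega=\sum_{i=1}^n dx_i\wedge dy_i ,$$ and $\Gamma$ is a subgroup of the unitary group $\mathrm U(n)$, acting on $U\subset\mathbb R^{2n}=\mathbb C^n$, $z_i=x_i+\sqrt{-1}\,y_i$, by (restrictions of) unitary linear maps. -/

import Mathlib

open scoped ContDiff

/-- A (smooth) orbifold chart `(U, V, φ, Γ)` of dimension `m` on a topological space `X`: an open
set `U ⊆ ℝᵐ`, a finite group `Γ` of diffeomorphisms of `U`, and a `Γ`-invariant map `φ : U → X`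
inducing a homeomorphism from `U / Γ` onto the open subset `V = φ(U)` of `X`.

The maps `act γ` and `φ` are total functions, only their restrictions to `U` are meaningful. -/
structure OrbifoldChart (X : Type*) [TopologicalSpace X] (m : ℕ) where
  /-- The domain of the chart. -/
  U : Set (EuclideanSpace ℝ (Fin m))
  isOpen_U : IsOpen U
  /-- The local group of the chart. -/
  Γ : Type
  [groupΓ : Group Γ]
  [finiteΓ : Finite Γ]
  /-- The action of the local group on the domain. -/
  act : Γ → EuclideanSpace ℝ (Fin m) → EuclideanSpace ℝ (Fin m)
  act_mem : ∀ γ, ∀ x ∈ U, act γ x ∈ U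
  act_one : ∀ x ∈ U, act 1 x = x
  act_mul : ∀ γ γ', ∀ x ∈ U, act (γ * γ') x = act γ (act γ' x)
  act_smooth : ∀ γ, ContDiffOn ℝ ∞ (act γ) U
  /-- `Γ` is a group of diffeomorphisms of `U`: only the identity acts trivially. -/
  act_faithful : ∀ γ, (∀ x ∈ U, act γ x = x) → γ = 1
  /-- The action is also faithful on each connected component of `U`. For connected `U` this is
  the preceding condition. -/
  act_faithful_component : ∀ γ, ∀ x ∈ U,
    (∀ y ∈ connectedComponentIn U x, act γ y = y) → γ = 1
  /-- The map to `X`. -/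
  φ : EuclideanSpace ℝ (Fin m) → X
  /-- The map `U / Γ → X` is well defined and injective. -/
  φ_eq_iff : ∀ x ∈ U, ∀ y ∈ U, φ x = φ y ↔ ∃ γ, act γ x = y
  /-- The map `U / Γ → X` is continuous. -/
  φ_continuousOn : ContinuousOn φ U
  /-- The map `U / Γ → X` is open. -/
  φ_open : ∀ W ⊆ U, IsOpen W → IsOpen (φ '' W)

attribute [instance] OrbifoldChart.groupΓ OrbifoldChart.finiteΓ

namespace OrbifoldChart

variable {X : Type*} [TopologicalSpace X] {m : ℕ}

/-- The open subset `V = φ(U)` of `X` covered by an orbifold chart. -/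
def V (c : OrbifoldChart X m) : Set X := c.φ '' c.U

/-- An embedding of the chart `d` into the chart `c`: a group monomorphism `ρ : Γ_d → Γ_c` and a
`ρ`-equivariant smooth open embedding `U_d → U_c` (a diffeomorphism onto an open subset) over
`X`. -/
structure Embedding (d c : OrbifoldChart X m) where
  /-- The monomorphism of local groups. -/
  ρ : d.Γ →* c.Γ
  ρ_injective : Function.Injective ρ
  /-- The open embedding of the domains (meaningful on `U_d`). -/
  toFun : EuclideanSpace ℝ (Fin m) → EuclideanSpace ℝ (Fin m)
  mapsTo : Set.MapsTo toFun d.U c.U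
  smooth : ContDiffOn ℝ ∞ toFun d.U
  isOpen_image : IsOpen (toFun '' d.U)
  exists_smooth_inverse : ∃ g : EuclideanSpace ℝ (Fin m) → EuclideanSpace ℝ (Fin m),
    ContDiffOn ℝ ∞ g (toFun '' d.U) ∧ ∀ x ∈ d.U, g (toFun x) = x
  equivariant : ∀ γ, ∀ x ∈ d.U, toFun (d.act γ x) = c.act (ρ γ) (toFun x)
  comm : ∀ x ∈ d.U, c.φ (toFun x) = d.φ x

/-- Two orbifold charts are compatible if around every common point there is an orbifold chart
that embeds into both of them. -/
def Compatible (c c' : OrbifoldChart X m) : Prop :=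
  ∀ x ∈ c.V ∩ c'.V, ∃ d : OrbifoldChart X m,
    x ∈ d.V ∧ d.V ⊆ c.V ∩ c'.V ∧ Nonempty (Embedding d c) ∧ Nonempty (Embedding d c')

end OrbifoldChart

/-- An `m`-dimensional orbifold structure on `X`, given by an atlas of orbifold charts: the open
sets `V_a` cover `X`, and around every point of `V_a ∩ V_b` there is a chart of the atlas which
embeds into the charts `a` and `b`. -/
structure OrbifoldAtlas (X : Type*) [TopologicalSpace X] (m : ℕ) where
  /-- The index set of the atlas. -/
  Index : Type*
  /-- The charts of the atlas. -/
  chart : Index → OrbifoldChart X m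
  cover : ∀ x : X, ∃ a, x ∈ (chart a).V
  compatible : ∀ a b, ∀ x ∈ (chart a).V ∩ (chart b).V, ∃ d,
    x ∈ (chart d).V ∧ (chart d).V ⊆ (chart a).V ∩ (chart b).V ∧
      Nonempty ((chart d).Embedding (chart a)) ∧ Nonempty ((chart d).Embedding (chart b))

/-- The pullback `f^* η` of a differential `k`-form on (an open subset of) `ℝᵐ`. -/
noncomputable def formPullback {m k : ℕ}
    (f : EuclideanSpace ℝ (Fin m) → EuclideanSpace ℝ (Fin m))
    (η : EuclideanSpace ℝ (Fin m) → EuclideanSpace ℝ (Fin m) [⋀^Fin k]→L[ℝ] ℝ) :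
    EuclideanSpace ℝ (Fin m) → EuclideanSpace ℝ (Fin m) [⋀^Fin k]→L[ℝ] ℝ :=
  fun x => (η (f x)).compContinuousLinearMap (fderiv ℝ f x)

namespace OrbifoldAtlas

variable {X : Type*} [TopologicalSpace X] {m : ℕ}

/-- `c` is an orbifold chart of the orbifold: it is compatible with all charts of the atlas. -/
def IsOrbifoldChart (A : OrbifoldAtlas X m) (c : OrbifoldChart X m) : Prop :=
  ∀ a, c.Compatible (A.chart a)

/-- An orbifold differential `k`-form: a family of smooth `k`-forms on the domains `U_a` of the
charts, each invariant under the local group, which agree under all changes of charts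
`U_a ⊇ i(U_d) → j(U_d) ⊆ U_b`, `j ∘ i⁻¹`. -/
structure DiffForm (A : OrbifoldAtlas X m) (k : ℕ) where
  /-- The local expression in each chart of the atlas (meaningful on `U_a`). -/
  form : A.Index → EuclideanSpace ℝ (Fin m) → EuclideanSpace ℝ (Fin m) [⋀^Fin k]→L[ℝ] ℝ
  smooth : ∀ a, ContDiffOn ℝ ∞ (form a) (A.chart a).U
  invariant : ∀ a γ, ∀ x ∈ (A.chart a).U,
    formPullback ((A.chart a).act γ) (form a) x = form a x
  agree : ∀ a b d (i : (A.chart d).Embedding (A.chart a)) (j : (A.chart d).Embedding (A.chart b)),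
    ∀ x ∈ (A.chart d).U, formPullback i.toFun (form a) x = formPullback j.toFun (form b) x

/-- The orbifold form `Ω` has the expression `η` in the orbifold chart `c`: `η` agrees with all
the local expressions of `Ω` under all changes of charts. -/
def DiffForm.HasExpression {A : OrbifoldAtlas X m} {k : ℕ} (Ω : A.DiffForm k)
    (c : OrbifoldChart X m)
    (η : EuclideanSpace ℝ (Fin m) → EuclideanSpace ℝ (Fin m) [⋀^Fin k]→L[ℝ] ℝ) : Prop :=
  ∀ (a : A.Index) (d : OrbifoldChart X m) (i : d.Embedding c) (j : d.Embedding (A.chart a)),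
    ∀ x ∈ d.U, formPullback i.toFun η x = formPullback j.toFun (Ω.form a) x

/-- An orbifold symplectic form: a closed and nondegenerate orbifold `2`-form. -/
structure DiffForm.IsSymplectic {A : OrbifoldAtlas X m} (Ω : A.DiffForm 2) : Prop where
  closed : ∀ a, ∀ x ∈ (A.chart a).U, extDeriv (Ω.form a) x = 0
  nondegenerate : ∀ a, ∀ x ∈ (A.chart a).U, ∀ v, v ≠ 0 → ∃ w, Ω.form a x ![v, w] ≠ 0

end OrbifoldAtlas

/-- The index of the coordinate `x_i` on `ℝ²ⁿ`, with coordinates `(x_1, y_1, …, x_n, y_n)`. -/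
def xIndex {n : ℕ} (i : Fin n) : Fin (2 * n) := ⟨2 * i, by omega⟩

/-- The index of the coordinate `y_i` on `ℝ²ⁿ`, with coordinates `(x_1, y_1, …, x_n, y_n)`. -/
def yIndex {n : ℕ} (i : Fin n) : Fin (2 * n) := ⟨2 * i + 1, by omega⟩

/-- The standard symplectic form `∑ dx_i ∧ dy_i` on `ℝ²ⁿ`, as an alternating form. -/
noncomputable def stdSymplecticForm (n : ℕ) : EuclideanSpace ℝ (Fin (2 * n)) [⋀^Fin 2]→L[ℝ] ℝ where
  toFun v := ∑ i : Fin n, (v 0 (xIndex i) * v 1 (yIndex i) - v 0 (yIndex i) * v 1 (xIndex i))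
  map_update_add' := by
    intro _ v j x y
    rw [← Finset.sum_add_distrib]
    refine Finset.sum_congr rfl fun i _ => ?_
    fin_cases j <;> simp [Function.update] <;> ring
  map_update_smul' := by
    intro _ v j c x
    rw [smul_eq_mul, Finset.mul_sum]
    refine Finset.sum_congr rfl fun i _ => ?_
    fin_cases j <;> simp [Function.update] <;> ring
  cont := by fun_prop
  map_eq_zero_of_eq' := by
    intro v i j hij hne
    have h : v 0 = v 1 := by
      fin_cases i <;> fin_cases j <;> simp_all
    refine Finset.sum_eq_zero fun i _ => ?_
    rw [h]
    ring

/-- The complex coordinates `z_i = x_i + √-1 y_i` of a point of `ℝ²ⁿ = ℂⁿ`. -/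
noncomputable def complexCoords {n : ℕ} (v : EuclideanSpace ℝ (Fin (2 * n))) : Fin n → ℂ :=
  fun i => ⟨v (xIndex i), v (yIndex i)⟩

/-- The local group `Γ` of the chart is a subgroup of `U(n)`: it acts on `U ⊆ ℝ²ⁿ = ℂⁿ` through an
injective homomorphism to the unitary group. -/
def OrbifoldChart.IsUnitary {X : Type*} [TopologicalSpace X] {n : ℕ}
    (c : OrbifoldChart X (2 * n)) : Prop :=
  ∃ r : c.Γ →* Matrix.unitaryGroup (Fin n) ℂ, Function.Injective r ∧
    ∀ γ, ∀ x ∈ c.U,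
      complexCoords (c.act γ x) = (r γ : Matrix (Fin n) (Fin n) ℂ).mulVec (complexCoords x)

/-!
Near `x₀` take a chart `a` of the atlas and a point `u` of its domain over `x₀`. The local group of
the required chart is the stabilizer of `u`. Coordinates around `u` are improved in three steps.

* Averaging over the stabilizer (`OrbifoldChart.exists_bochner_linearization`) gives coordinates in
  which it acts linearly, by its isotropy representation. This representation is injective, because
  an element of the local group with trivial `1`-jet at a point is trivial on the whole connected
  component of that point (`OrbifoldChart.eq_one_of_fderiv`).
* The equivariant Darboux theorem (`exists_equivariant_darboux`) makes the symplectic form constant.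
  It is proved by the Moser argument: if `B₀` is the value of the form at the origin, `B₀ + τ` the
  form and `σ` a primitive of `τ`, the flow of the field `X` with `ι_X (B₀ + θ τ) = - θ' σ`, where
  `θ` runs from `0` to `1`, carries `B₀` to `B₀ + τ`. The radial primitive `σ` is natural under
  linear maps, so the flow commutes with all linear symmetries of the form. As `X` vanishes to
  second order at the origin, the Picard operator of `X` is, to first order, a constant curve, and
  the inverse function theorem in the Banach space of curves gives a flow which depends smoothly on
  the initial point (`exists_smooth_flow`); smoothness of the Picard operator is
  `contDiff_nemytskii`.
* The polar decomposition of the form with respect to an invariant inner product gives an invariant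
  compatible complex structure, and a unitary frame for it gives linear coordinates in which the
  form is standard and the group unitary (`exists_unitary_coordinates`).

A small invariant convex neighbourhood of the origin in these coordinates is the domain of a chart
`c` with an embedding into `a` (`OrbifoldChart.exists_chart_of_parametrization`). It remains to see
that `c` is compatible with the atlas and that the form has the right expression with respect to all
changes of charts. Two maps into a chart over the same map to the orbifold agree, on a dense open
set, locally up to elements of the local group (`OrbifoldChart.mem_closure_interior_eq_act`). By
invariance and continuity of forms this suffices for the expression
(`OrbifoldAtlas.DiffForm.agree_of_embeddings`). If one of the maps is a submersion and the source is
connected, a single element is enough (`OrbifoldChart.exists_eq_act`); hence the homomorphism of an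
embedding hits the stabilizers of all points of its image, and small charts around a common point
factor through both `c` and a chart of the atlas (`OrbifoldAtlas.isOrbifoldChart_of_embedding`).
-/

open Topology

universe u

/-! ### Superposition operators on spaces of curves -/

/-- The superposition (Nemytskii) operator `γ ↦ f ∘ γ` between spaces of continuous maps on a
compact space. -/
def nemytskii (K : Type*) [TopologicalSpace K] {E F : Type*}
    [NormedAddCommGroup E] [NormedAddCommGroup F] (f : E → F) (hf : Continuous f) :
    C(K, E) → C(K, F) :=
  fun γ => ContinuousMap.comp ⟨f, hf⟩ γ

@[simp]
theorem nemytskii_apply {K : Type*} [TopologicalSpace K] {E F : Type*}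
    [NormedAddCommGroup E] [NormedAddCommGroup F] (f : E → F) (hf : Continuous f) (γ : C(K, E))
    (t : K) :
    nemytskii K f hf γ t = f (γ t) := rfl

/-- Pointwise application of a continuous family of operators to a continuous map. -/
noncomputable def pointwiseApply (K : Type*) [TopologicalSpace K] [CompactSpace K]
    (E F : Type*) [NormedAddCommGroup E] [NormedSpace ℝ E]
    [NormedAddCommGroup F] [NormedSpace ℝ F] :
    C(K, E →L[ℝ] F) →L[ℝ] C(K, E) →L[ℝ] C(K, F) :=
  LinearMap.mkContinuous₂ (E := C(K, E →L[ℝ] F)) (F := C(K, E)) (G := C(K, F))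
    (σ₁₃ := RingHom.id ℝ) (σ₂₃ := RingHom.id ℝ)
    (LinearMap.mk₂ ℝ (fun A η => ⟨fun t => A t (η t), by fun_prop⟩)
      (fun _ _ _ => by ext; simp) (fun _ _ _ => by ext; simp)
      (fun _ _ _ => by ext; simp) (fun _ _ _ => by ext; simp)) 1
    (fun A η => by
      rw [ContinuousMap.norm_le _ (by positivity)]
      intro t
      refine ((A t).le_opNorm _).trans ?_
      rw [one_mul]
      exact mul_le_mul (A.norm_coe_le_norm t) (η.norm_coe_le_norm t) (norm_nonneg _)
        (by positivity))

@[simp]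
theorem pointwiseApply_apply {K : Type*} [TopologicalSpace K] [CompactSpace K]
    {E F : Type*} [NormedAddCommGroup E] [NormedSpace ℝ E] [NormedAddCommGroup F]
    [NormedSpace ℝ F] (A : C(K, E →L[ℝ] F)) (η : C(K, E)) (t : K) :
    pointwiseApply K E F A η t = A t (η t) := rfl

theorem continuous_nemytskii {K : Type*} [TopologicalSpace K] {E F : Type*}
    [NormedAddCommGroup E] [NormedAddCommGroup F] (f : E → F) (hf : Continuous f) :
    Continuous (nemytskii K f hf) :=
  ContinuousMap.continuous_postcomp _

theorem hasFDerivAt_nemytskii {K : Type*} [TopologicalSpace K] [CompactSpace K]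
    {E F : Type*} [NormedAddCommGroup E] [NormedSpace ℝ E] [NormedAddCommGroup F]
    [NormedSpace ℝ F] (f : E → F) (hf : ContDiff ℝ 1 f) (γ : C(K, E)) :
    HasFDerivAt (nemytskii K f hf.continuous)
      (pointwiseApply K E F (nemytskii K (fderiv ℝ f) (hf.continuous_fderiv one_ne_zero) γ)) γ := by
  set N := nemytskii K (fderiv ℝ f) (hf.continuous_fderiv one_ne_zero) with hN
  rw [hasFDerivAt_iff_isLittleO_nhds_zero, Asymptotics.isLittleO_iff]
  intro ε hε
  have hcont : Filter.Tendsto N (𝓝 γ) (𝓝 (N γ)) := (continuous_nemytskii _ _).tendsto _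
  obtain ⟨δ, hδ, hball⟩ := Metric.tendsto_nhds_nhds.1 hcont ε hε
  filter_upwards [Metric.ball_mem_nhds (0 : C(K, E)) hδ] with η hη
  rw [ContinuousMap.norm_le _ (by positivity)]
  intro t
  have hη' : ‖η‖ < δ := by simpa using hη
  -- On the segment from `γ t` to `γ t + η t` the derivative stays within `ε` of `Df (γ t)`,
  -- because the whole curve `γ + s η` stays in the ball where `N` varies by less than `ε`.
  have key : ‖f (γ t + η t) - f (γ t) - fderiv ℝ f (γ t) (γ t + η t - γ t)‖
      ≤ ε * ‖γ t + η t - γ t‖ := by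
    refine (convex_segment (γ t) (γ t + η t)).norm_image_sub_le_of_norm_hasFDerivWithin_le'
      (f' := fderiv ℝ f)
      (fun z _ => ((hf.differentiable one_ne_zero) z).hasFDerivAt.hasFDerivWithinAt) ?_
      (left_mem_segment ℝ _ _) (right_mem_segment ℝ _ _)
    rintro z ⟨a, b, ha, hb, hab, rfl⟩
    have hz : a • γ t + b • (γ t + η t) = (γ + b • η) t := by
      simp only [ContinuousMap.add_apply, ContinuousMap.smul_apply]
      rw [smul_add, ← add_assoc, ← add_smul, hab, one_smul]
    have hd : dist (γ + b • η) γ < δ := by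
      rw [dist_eq_norm, add_sub_cancel_left, norm_smul, Real.norm_of_nonneg hb]
      have : b ≤ 1 := by linarith
      nlinarith [norm_nonneg η]
    have h1 := hball hd
    rw [dist_eq_norm] at h1
    rw [hz]
    exact (((N (γ + b • η) - N γ).norm_coe_le_norm t)).trans h1.le
  rw [add_sub_cancel_left] at key
  have heq : f (γ t + η t) - f (γ t) - fderiv ℝ f (γ t) (η t) =
      (nemytskii K f hf.continuous (γ + η) - nemytskii K f hf.continuous γ -
        pointwiseApply K E F (N γ) η) t := rfl
  rw [← heq]
  refine key.trans ?_
  exact mul_le_mul_of_nonneg_left (η.norm_coe_le_norm t) hε.le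

/-- The induction on the order of differentiability passes from `f : E → F` to its derivative, with
values in `E →L[ℝ] F`; this is why `E` and `F` have to live in the same universe. -/
theorem contDiff_nemytskii_nat {K : Type*} [TopologicalSpace K] [CompactSpace K]
    {E : Type u} [NormedAddCommGroup E] [NormedSpace ℝ E] (n : ℕ) :
    ∀ {F : Type u} [NormedAddCommGroup F] [NormedSpace ℝ F] (f : E → F) (hf : ContDiff ℝ ∞ f),
      ContDiff ℝ n (nemytskii K f hf.continuous) := by
  induction n with
  | zero =>
    intro F _ _ f hf
    exact contDiff_zero.2 (continuous_nemytskii _ _)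
  | succ n ih =>
    intro F _ _ f hf
    have h1 : ContDiff ℝ 1 f := hf.of_le (by exact_mod_cast le_top)
    have hf' : ContDiff ℝ ∞ (fderiv ℝ f) := hf.fderiv_right (by exact_mod_cast le_top)
    refine contDiff_succ_iff_hasFDerivAt (n := n).2
      ⟨fun γ => pointwiseApply K E F (nemytskii K (fderiv ℝ f) hf'.continuous γ), ?_,
        hasFDerivAt_nemytskii f h1⟩
    exact (pointwiseApply K E F).contDiff.comp (ih (fderiv ℝ f) hf')

/-- The superposition operator of a smooth map is smooth: its derivative is again made of a
superposition operator, that of the derivative. -/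
theorem contDiff_nemytskii {K : Type*} [TopologicalSpace K] [CompactSpace K]
    {E F : Type u} [NormedAddCommGroup E] [NormedSpace ℝ E] [NormedAddCommGroup F]
    [NormedSpace ℝ F] (f : E → F) (hf : ContDiff ℝ ∞ f) :
    ContDiff ℝ ∞ (nemytskii K f hf.continuous) :=
  contDiff_infty.2 fun n => contDiff_nemytskii_nat n f hf

/-! ### Smooth dependence of flows on the initial point -/

/-- The smooth inverse function theorem, with an inverse which is smooth on its whole domain. -/
theorem exists_openPartialHomeomorph_of_contDiffOn {E F : Type*} [NormedAddCommGroup E]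
    [NormedSpace ℝ E] [CompleteSpace E] [NormedAddCommGroup F] [NormedSpace ℝ F] {f : E → F}
    {a : E} {O : Set E} (hO : IsOpen O) (ha : a ∈ O) (hf : ContDiffOn ℝ ∞ f O) {f' : E ≃L[ℝ] F}
    (hf' : HasFDerivAt f (f' : E →L[ℝ] F) a) :
    ∃ e : OpenPartialHomeomorph E F, ⇑e = f ∧ a ∈ e.source ∧ e.source ⊆ O ∧
      ContDiffOn ℝ ∞ e.symm e.target := by
  have hfa : ContDiffAt ℝ ∞ f a := hf.contDiffAt (hO.mem_nhds ha)
  set e₀ := hfa.toOpenPartialHomeomorph f hf' (by simp) with he₀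
  have hcont : ContinuousOn (fderiv ℝ f) O := hf.continuousOn_fderiv_of_isOpen hO (by simp)
  -- The domain is cut down to the open set of points at which the derivative is invertible.
  set S := O ∩ (fderiv ℝ f) ⁻¹' Set.range ((↑) : (E ≃L[ℝ] F) → E →L[ℝ] F) with hS
  have hSo : IsOpen S := hcont.isOpen_inter_preimage hO ContinuousLinearEquiv.isOpen
  have hcoe : ⇑e₀ = f := hfa.toOpenPartialHomeomorph_coe hf' (by simp)
  refine ⟨e₀.restrOpen S hSo, hcoe, ?_, ?_, ?_⟩
  · exact ⟨hfa.mem_toOpenPartialHomeomorph_source hf' (by simp), ha, f', hf'.fderiv.symm⟩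
  · exact fun x hx => hx.2.1
  · intro y hy
    have hx := (e₀.restrOpen S hSo).map_target hy
    obtain ⟨-, hxO, A, hA⟩ := hx
    have hfx : ContDiffAt ℝ ∞ f ((e₀.restrOpen S hSo).symm y) := hf.contDiffAt (hO.mem_nhds hxO)
    refine (OpenPartialHomeomorph.contDiffAt_symm _ hy (f₀' := A) ?_ ?_).contDiffWithinAt
    · rw [hA]
      exact (hfx.differentiableAt (by simp)).hasFDerivAt
    · exact hfx

/-- The operator of integration from `0`, on continuous curves over the unit interval. -/
noncomputable def primitiveCLM (E : Type*) [NormedAddCommGroup E] [NormedSpace ℝ E] :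
    C(unitInterval, E) →L[ℝ] C(unitInterval, E) :=
  LinearMap.mkContinuous (σ := RingHom.id ℝ) (E := C(unitInterval, E)) (F := C(unitInterval, E))
    { toFun := fun η =>
        ⟨fun t => ∫ s in (0 : ℝ)..t, Set.IccExtend zero_le_one η s,
          (intervalIntegral.continuous_primitive
            (fun _ _ => (η.continuous.Icc_extend').intervalIntegrable _ _) 0).comp
              continuous_subtype_val⟩
      map_add' := fun η ξ => by
        ext t
        exact intervalIntegral.integral_add (η.continuous.Icc_extend'.intervalIntegrable _ _)
          (ξ.continuous.Icc_extend'.intervalIntegrable _ _)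
      map_smul' := fun c η => by
        ext t
        exact intervalIntegral.integral_smul c (Set.IccExtend zero_le_one η) } 1
    (fun η => by
      rw [ContinuousMap.norm_le _ (by positivity)]
      intro t
      refine (intervalIntegral.norm_integral_le_of_norm_le_const (C := ‖η‖)
        fun s _ => η.norm_coe_le_norm _).trans ?_
      rw [sub_zero, abs_of_nonneg t.2.1, one_mul]
      exact mul_le_of_le_one_right (norm_nonneg _) t.2.2)

/-- The inclusion of points as constant curves. -/
noncomputable def constCLM (E : Type*) [NormedAddCommGroup E] [NormedSpace ℝ E] :
    E →L[ℝ] C(unitInterval, E) :=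
  LinearMap.mkContinuous (σ := RingHom.id ℝ) (E := E) (F := C(unitInterval, E))
    { toFun := fun x => ContinuousMap.const _ x
      map_add' := fun _ _ => rfl
      map_smul' := fun _ _ => rfl } 1
    (fun x => by
      rw [ContinuousMap.norm_le _ (by positivity)]
      intro t
      rw [one_mul]
      exact le_rfl)

@[simp]
theorem constCLM_apply {E : Type*} [NormedAddCommGroup E] [NormedSpace ℝ E] (x : E)
    (t : unitInterval) : constCLM E x t = x := rfl

/-- The graph `t ↦ (t, γ t)` of a curve. -/
def graphCurve {E : Type*} [NormedAddCommGroup E] (γ : C(unitInterval, E)) :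
    C(unitInterval, ℝ × E) :=
  ⟨fun t => ((t : ℝ), γ t), by fun_prop⟩

@[simp]
theorem graphCurve_apply {E : Type*} [NormedAddCommGroup E] (γ : C(unitInterval, E))
    (t : unitInterval) : graphCurve γ t = ((t : ℝ), γ t) := rfl

theorem graphCurve_eq {E : Type*} [NormedAddCommGroup E] [NormedSpace ℝ E] :
    (graphCurve : C(unitInterval, E) → C(unitInterval, ℝ × E)) = fun γ => graphCurve 0 +
      (ContinuousLinearMap.inr ℝ ℝ E).compLeftContinuous ℝ unitInterval γ := by
  ext γ t <;> simp [graphCurve]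

theorem hasFDerivAt_graphCurve {E : Type*} [NormedAddCommGroup E] [NormedSpace ℝ E]
    (γ : C(unitInterval, E)) :
    HasFDerivAt (graphCurve : C(unitInterval, E) → C(unitInterval, ℝ × E))
      ((ContinuousLinearMap.inr ℝ ℝ E).compLeftContinuous ℝ unitInterval) γ := by
  rw [graphCurve_eq]
  exact (ContinuousLinearMap.hasFDerivAt _).const_add _

theorem contDiff_graphCurve {E : Type*} [NormedAddCommGroup E] [NormedSpace ℝ E] :
    ContDiff ℝ ∞ (graphCurve : C(unitInterval, E) → C(unitInterval, ℝ × E)) := by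
  rw [graphCurve_eq]
  exact contDiff_const.add (ContinuousLinearMap.contDiff _)

/-- The Picard operator of the time-dependent vector field `X`: it maps an initial point `x` and a
curve `γ` to the curve `t ↦ x + ∫₀ᵗ X (s, γ s) ds`. -/
noncomputable def picardMap {E : Type*} [NormedAddCommGroup E] [NormedSpace ℝ E] (X : ℝ × E → E)
    (hX : Continuous X) (p : E × C(unitInterval, E)) : C(unitInterval, E) :=
  constCLM E p.1 + primitiveCLM E (nemytskii unitInterval X hX (graphCurve p.2))

theorem contDiff_picardMap {E : Type u} [NormedAddCommGroup E] [NormedSpace ℝ E] {X : ℝ × E → E}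
    (hX : ContDiff ℝ ∞ X) : ContDiff ℝ ∞ (picardMap X hX.continuous) := by
  refine ((constCLM E).contDiff.comp contDiff_fst).add ((primitiveCLM E).contDiff.comp ?_)
  exact (contDiff_nemytskii X hX).comp (contDiff_graphCurve.comp contDiff_snd)

theorem hasFDerivAt_picardMap {E : Type u} [NormedAddCommGroup E] [NormedSpace ℝ E]
    {X : ℝ × E → E} (hX : ContDiff ℝ ∞ X) (p : E × C(unitInterval, E)) :
    HasFDerivAt (picardMap X hX.continuous)
      ((constCLM E).comp (ContinuousLinearMap.fst ℝ E C(unitInterval, E)) +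
        (primitiveCLM E).comp ((pointwiseApply unitInterval (ℝ × E) E
          (nemytskii unitInterval (fderiv ℝ X) (hX.continuous_fderiv (by simp))
            (graphCurve p.2))).comp
          (((ContinuousLinearMap.inr ℝ ℝ E).compLeftContinuous ℝ unitInterval).comp
            (ContinuousLinearMap.snd ℝ E C(unitInterval, E))))) p := by
  refine ((constCLM E).hasFDerivAt.comp p hasFDerivAt_fst).add
    ((primitiveCLM E).hasFDerivAt.comp p ?_)
  have h1 : ContDiff ℝ 1 X := hX.of_le (by exact_mod_cast le_top)
  exact (hasFDerivAt_nemytskii X h1 (graphCurve p.2)).comp p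
    ((hasFDerivAt_graphCurve p.2).comp p hasFDerivAt_snd)

/-- A time-dependent vector field which vanishes to second order at the fixed point `0` has, near
`0`, a flow on the unit time interval which depends smoothly on the initial point. The curves of
the flow are the only small fixed points of the Picard operator. -/
theorem exists_smooth_flow {E : Type u} [NormedAddCommGroup E] [NormedSpace ℝ E] [CompleteSpace E]
    {X : ℝ × E → E} (hX : ContDiff ℝ ∞ X) (h0 : ∀ t, X (t, 0) = 0)
    (h1 : ∀ t v, fderiv ℝ X (t, 0) (0, v) = 0) :
    ∃ Φ : E → C(unitInterval, E), Φ 0 = 0 ∧ (∀ᶠ x in 𝓝 0, ContDiffAt ℝ ∞ Φ x) ∧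
      (∀ᶠ x in 𝓝 0, Φ x = picardMap X hX.continuous (x, Φ x)) ∧
      ∀ᶠ p : E × C(unitInterval, E) in 𝓝 0, p.2 = picardMap X hX.continuous p → p.2 = Φ p.1 := by
  set P := picardMap X hX.continuous with hP
  -- The curves of the flow are the zeros of the second component of `G`, to which the inverse
  -- function theorem applies.
  set G : E × C(unitInterval, E) → E × C(unitInterval, E) := fun p => (p.1, p.2 - P p) with hG
  have hGs : ContDiff ℝ ∞ G :=
    contDiff_fst.prodMk (contDiff_snd.sub (contDiff_picardMap hX))
  have hP0 : P 0 = 0 := by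
    have : nemytskii unitInterval X hX.continuous (graphCurve 0) = 0 := by
      ext t; simp [h0]
    simp [hP, picardMap, this]
  have hG0 : G 0 = 0 := by simp [hG, hP0]
  -- The derivative of `G` at the origin is unipotent, since `X` has no linear part.
  set D : (E × C(unitInterval, E)) ≃L[ℝ] (E × C(unitInterval, E)) :=
    ContinuousLinearEquiv.equivOfInverse
      ((ContinuousLinearMap.fst ℝ E C(unitInterval, E)).prod
        (ContinuousLinearMap.snd ℝ E C(unitInterval, E) -
          (constCLM E).comp (ContinuousLinearMap.fst ℝ E C(unitInterval, E))))
      ((ContinuousLinearMap.fst ℝ E C(unitInterval, E)).prod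
        (ContinuousLinearMap.snd ℝ E C(unitInterval, E) +
          (constCLM E).comp (ContinuousLinearMap.fst ℝ E C(unitInterval, E))))
      (fun p => by ext <;> simp) (fun p => by ext <;> simp) with hD
  have hGD : HasFDerivAt G (D : (E × C(unitInterval, E)) →L[ℝ] (E × C(unitInterval, E))) 0 := by
    have hPD := hasFDerivAt_picardMap hX (0 : E × C(unitInterval, E))
    have h := (hasFDerivAt_fst (𝕜 := ℝ) (E := E) (F := C(unitInterval, E)) (p := 0)).prodMk
      ((hasFDerivAt_snd (𝕜 := ℝ) (E := E) (F := C(unitInterval, E)) (p := 0)).sub hPD)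
    refine h.congr_fderiv ?_
    refine ContinuousLinearMap.ext fun p => ?_
    have hz : pointwiseApply unitInterval (ℝ × E) E
        (nemytskii unitInterval (fderiv ℝ X) (hX.continuous_fderiv (by simp)) (graphCurve 0))
          ((ContinuousLinearMap.inr ℝ ℝ E).compLeftContinuous ℝ unitInterval p.2) = 0 := by
      ext t
      simp [h1]
    simp [hD]
    exact (congrArg (primitiveCLM E) hz).trans (map_zero _)
  obtain ⟨e, heG, he0, -, hes⟩ := exists_openPartialHomeomorph_of_contDiffOn isOpen_univ
    (Set.mem_univ 0) hGs.contDiffOn hGD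
  have he00 : e 0 = 0 := by rw [heG, hG0]
  have hes0 : e.symm 0 = 0 := by rw [← he00, e.left_inv he0, he00]
  have ht0 : (0 : E × C(unitInterval, E)) ∈ e.target := by
    have := e.map_source he0
    rwa [he00] at this
  have hι : Filter.Tendsto (fun x : E => (x, (0 : C(unitInterval, E)))) (𝓝 0) (𝓝 0) :=
    Continuous.tendsto' (by fun_prop) _ _ rfl
  have hnear : ∀ᶠ x : E in 𝓝 0, (x, (0 : C(unitInterval, E))) ∈ e.target :=
    hι.eventually (e.open_target.mem_nhds ht0)
  refine ⟨fun x => (e.symm (x, 0)).2, ?_, ?_, ?_, ?_⟩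
  · have : ((0 : E), (0 : C(unitInterval, E))) = 0 := rfl
    simp only [this, hes0, Prod.snd_zero]
  · filter_upwards [hnear] with x hx
    have h2 : ContDiffAt ℝ ∞ e.symm (x, 0) := hes.contDiffAt (e.open_target.mem_nhds hx)
    exact contDiffAt_snd.comp x (h2.comp x (contDiffAt_id.prodMk contDiffAt_const))
  · filter_upwards [hnear] with x hx
    have h2 := e.right_inv hx
    rw [heG, hG, Prod.mk.injEq] at h2
    have h3 : e.symm (x, 0) = (x, (e.symm (x, 0)).2) := Prod.ext h2.1 rfl
    have h4 := sub_eq_zero.1 h2.2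
    rw [h3] at h4
    exact h4
  · filter_upwards [e.open_source.mem_nhds he0] with p hp hpP
    have h2 : e p = (p.1, 0) := by
      rw [heG]
      exact Prod.ext rfl (sub_eq_zero.2 hpP)
    rw [← h2, e.left_inv hp]

/-! ### The Poincaré lemma for two-forms -/

/-- Differentiation under the integral sign for a smooth integrand: the integral is a composition of
a superposition operator with continuous linear maps. -/
theorem hasFDerivAt_integral_of_contDiff {E F : Type u} [NormedAddCommGroup E] [NormedSpace ℝ E]
    [NormedAddCommGroup F] [NormedSpace ℝ F] [CompleteSpace F] {S : ℝ × E → F}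
    (hS : ContDiff ℝ ∞ S) :
    ContDiff ℝ ∞ (fun x => ∫ t in (0 : ℝ)..1, S (t, x)) ∧
      ∀ x v, fderiv ℝ (fun x => ∫ t in (0 : ℝ)..1, S (t, x)) x v =
        ∫ t in (0 : ℝ)..1, fderiv ℝ S (t, x) (0, v) := by
  set ev : C(unitInterval, F) →L[ℝ] F := ContinuousMap.evalCLM ℝ (1 : unitInterval) with hev
  have hint : ∀ η : C(unitInterval, F), ∀ f : ℝ → F, (∀ t : unitInterval, η t = f t) →
      ev (primitiveCLM F η) = ∫ t in (0 : ℝ)..1, f t := by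
    intro η f h
    have : ev (primitiveCLM F η) =
      ∫ s in (0 : ℝ)..((1 : unitInterval) : ℝ), Set.IccExtend zero_le_one η s := rfl
    rw [this, Set.Icc.coe_one]
    refine intervalIntegral.integral_congr fun t ht => ?_
    rw [Set.uIcc_of_le zero_le_one] at ht
    rw [Set.IccExtend_of_mem _ _ ht, h]
  have heq : (fun x => ∫ t in (0 : ℝ)..1, S (t, x)) = fun x => ev (primitiveCLM F
      (nemytskii unitInterval S hS.continuous (graphCurve (constCLM E x)))) :=
    funext fun x => (hint _ _ fun t => by simp).symm
  have h1 : ContDiff ℝ 1 S := hS.of_le (by exact_mod_cast le_top)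
  constructor
  · rw [heq]
    exact ev.contDiff.comp ((primitiveCLM F).contDiff.comp
      ((contDiff_nemytskii S hS).comp (contDiff_graphCurve.comp (constCLM E).contDiff)))
  · intro x v
    have hd := ev.hasFDerivAt.comp x ((primitiveCLM F).hasFDerivAt.comp x
      ((hasFDerivAt_nemytskii S h1 (graphCurve (constCLM E x))).comp x
        ((hasFDerivAt_graphCurve (constCLM E x)).comp x (constCLM E).hasFDerivAt)))
    rw [heq]
    refine (congrArg (fun A => A v) hd.fderiv).trans ?_
    exact hint _ _ fun t => rfl

/-- The primitive of a `2`-form which is given by radial integration (the homotopy operator of the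
Poincaré lemma). -/
noncomputable def radialPrimitive {E : Type*} [NormedAddCommGroup E] [NormedSpace ℝ E]
    (τ : E → E →L[ℝ] E →L[ℝ] ℝ) (x : E) : E →L[ℝ] ℝ :=
  ∫ t in (0 : ℝ)..1, t • τ (t • x) x

section RadialPrimitive

variable {E : Type u} [NormedAddCommGroup E] [NormedSpace ℝ E] {τ : E → E →L[ℝ] E →L[ℝ] ℝ}

theorem contDiff_radial_integrand (hτ : ContDiff ℝ ∞ τ) :
    ContDiff ℝ ∞ (fun p : ℝ × E => p.1 • τ (p.1 • p.2) p.2) := by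
  fun_prop

theorem fderiv_radial_integrand (hτ : ContDiff ℝ ∞ τ) (t : ℝ) (x v : E) :
    fderiv ℝ (fun p : ℝ × E => p.1 • τ (p.1 • p.2) p.2) (t, x) (0, v) =
      t • (t • fderiv ℝ τ (t • x) v x + τ (t • x) v) := by
  have hd : DifferentiableAt ℝ (fun p : ℝ × E => p.1 • τ (p.1 • p.2) p.2) (t, x) :=
    (contDiff_radial_integrand hτ).differentiable (by simp) _
  have h1 : HasFDerivAt (fun y : E => (t, y)) (ContinuousLinearMap.inr ℝ ℝ E) x :=
    (hasFDerivAt_const t x).prodMk (hasFDerivAt_id x)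
  have h2 := hd.hasFDerivAt.comp x h1
  have hτd : HasFDerivAt τ (fderiv ℝ τ (t • x)) (t • x) :=
    (hτ.differentiable (by simp) _).hasFDerivAt
  have h3a : HasFDerivAt (fun y : E => τ (t • y))
      ((fderiv ℝ τ (t • x)).comp (t • ContinuousLinearMap.id ℝ E)) x := by
    have hm : HasFDerivAt (fun y : E => t • y) (t • ContinuousLinearMap.id ℝ E) x :=
      (hasFDerivAt_id x).const_smul t
    exact HasFDerivAt.comp (G := E →L[ℝ] E →L[ℝ] ℝ) (g := τ) (g' := fderiv ℝ τ (t • x)) x hτd hm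
  have h3 : HasFDerivAt (fun y : E => t • τ (t • y) y) _ x :=
    (h3a.clm_apply (hasFDerivAt_id x)).const_smul t
  have h4 := congrArg (fun A => A v) (h2.unique h3)
  simp only [ContinuousLinearMap.comp_apply, ContinuousLinearMap.inr_apply] at h4
  rw [h4]
  simp
  abel

theorem contDiff_radialPrimitive (hτ : ContDiff ℝ ∞ τ) : ContDiff ℝ ∞ (radialPrimitive τ) :=
  (hasFDerivAt_integral_of_contDiff (contDiff_radial_integrand hτ)).1

theorem fderiv_radialPrimitive (hτ : ContDiff ℝ ∞ τ) (x v w : E) :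
    fderiv ℝ (radialPrimitive τ) x v w =
      ∫ t in (0 : ℝ)..1, t * (t * fderiv ℝ τ (t • x) v x w + τ (t • x) v w) := by
  have h := (hasFDerivAt_integral_of_contDiff (contDiff_radial_integrand hτ)).2 x v
  have h' : fderiv ℝ (radialPrimitive τ) x v =
      ∫ t in (0 : ℝ)..1, t • (t • fderiv ℝ τ (t • x) v x + τ (t • x) v) := by
    refine h.trans (intervalIntegral.integral_congr fun t _ => fderiv_radial_integrand hτ t x v)
  have hc := hτ.continuous_fderiv (n := ∞) (by simp)
  have hcτ : Continuous τ := hτ.continuous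
  rw [h', ContinuousLinearMap.intervalIntegral_apply]
  · simp [mul_add]
  · exact Continuous.intervalIntegrable (by fun_prop) _ _

theorem radialPrimitive_apply (hτ : Continuous τ) (x w : E) :
    radialPrimitive τ x w = ∫ t in (0 : ℝ)..1, t * τ (t • x) x w := by
  rw [radialPrimitive, ContinuousLinearMap.intervalIntegral_apply]
  · simp
  · exact Continuous.intervalIntegrable (by fun_prop) _ _

@[simp]
theorem radialPrimitive_zero : radialPrimitive τ 0 = 0 := by
  simp [radialPrimitive]

theorem fderiv_radialPrimitive_zero (hτ : ContDiff ℝ ∞ τ) (h0 : τ 0 = 0) (v : E) :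
    fderiv ℝ (radialPrimitive τ) 0 v = 0 := by
  ext w
  rw [fderiv_radialPrimitive hτ]
  simp [h0]

/-- The Poincaré lemma for `2`-forms which are closed on a ball around the origin. -/
theorem radialPrimitive_extDeriv (hτ : ContDiff ℝ ∞ τ) (halt : ∀ x v, τ x v v = 0) {r : ℝ}
    (hcl : ∀ x ∈ Metric.ball (0 : E) r, ∀ u v w,
      fderiv ℝ τ x u v w - fderiv ℝ τ x v u w + fderiv ℝ τ x w u v = 0)
    {x : E} (hx : x ∈ Metric.ball (0 : E) r) (u v : E) :
    fderiv ℝ (radialPrimitive τ) x u v - fderiv ℝ (radialPrimitive τ) x v u = τ x u v := by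
  have hc := hτ.continuous_fderiv (n := ∞) (by simp)
  have hcτ : Continuous τ := hτ.continuous
  rw [fderiv_radialPrimitive hτ, fderiv_radialPrimitive hτ, ← intervalIntegral.integral_sub
    (Continuous.intervalIntegrable (by fun_prop) _ _)
    (Continuous.intervalIntegrable (by fun_prop) _ _)]
  have hanti : ∀ y, τ y v u = - τ y u v := by
    intro y
    have h := halt y (u + v)
    simp only [map_add, add_apply, halt] at h
    linarith
  -- By closedness the integrand is the derivative of `t ↦ t² τ (t x) u v`.
  have hderiv : ∀ t ∈ Set.uIcc (0 : ℝ) 1, HasDerivAt (fun t : ℝ => t ^ 2 * τ (t • x) u v)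
      (t * (t * fderiv ℝ τ (t • x) u x v + τ (t • x) u v) -
        t * (t * fderiv ℝ τ (t • x) v x u + τ (t • x) v u)) t := by
    intro t ht
    rw [Set.uIcc_of_le zero_le_one] at ht
    have htx : t • x ∈ Metric.ball (0 : E) r := by
      rw [mem_ball_zero_iff] at hx ⊢
      rw [norm_smul, Real.norm_of_nonneg ht.1]
      nlinarith [norm_nonneg x, ht.2]
    have h1 : HasDerivAt (fun t : ℝ => t • x) x t := by
      simpa using (hasDerivAt_id t).smul_const x
    have h2 := ((hτ.differentiable (by simp) (t • x)).hasFDerivAt.comp_hasDerivAt t h1)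
    have h3 := (h2.clm_apply (hasDerivAt_const t u)).clm_apply (hasDerivAt_const t v)
    have h4 := (hasDerivAt_pow 2 t).mul h3
    refine h4.congr_deriv ?_
    have h5 := hcl _ htx x u v
    simp only [hanti, map_zero, add_zero, Function.comp_apply]
    push_cast
    linear_combination t ^ 2 * h5
  rw [intervalIntegral.integral_eq_sub_of_hasDerivAt hderiv
    (Continuous.intervalIntegrable (by fun_prop) _ _)]
  simp

end RadialPrimitive

/-! ### The Moser argument -/

section AffineFamily

variable {V W : Type*} [NormedAddCommGroup V] [NormedSpace ℝ V] [NormedAddCommGroup W]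
  [NormedSpace ℝ W]

theorem contDiff_const_add_smul (b : W) {c : V → ℝ} {f : V → W} (hc : ContDiff ℝ ∞ c)
    (hf : ContDiff ℝ ∞ f) : ContDiff ℝ ∞ (fun p => b + c p • f p) :=
  contDiff_const.add (hc.smul hf)

theorem hasFDerivAt_const_add_const_smul (b : W) (c : ℝ) {f : V → W} {f' : V →L[ℝ] W} {x : V}
    (hf : HasFDerivAt f f' x) : HasFDerivAt (fun y => b + c • f y) (c • f') x :=
  (hf.const_smul c).const_add b

theorem hasDerivAt_const_add_smul_comp (b : W) {c : ℝ → ℝ} {c' t : ℝ} {f : V → W}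
    {f' : V →L[ℝ] W} {Γ : ℝ → V} {Γ' : V} (hc : HasDerivAt c c' t) (hf : HasFDerivAt f f' (Γ t))
    (hΓ : HasDerivAt Γ Γ' t) :
    HasDerivAt (fun s => b + c s • f (Γ s)) (c t • f' Γ' + c' • f (Γ t)) t :=
  (hc.smul (hf.comp_hasDerivAt t hΓ)).const_add b

end AffineFamily

/-- The input of the Moser argument: a constant alternating form `B₀` and a smooth alternating form
`τ` vanishing at the origin, closed near the origin, such that all forms `B₀ + s τ`, `0 ≤ s ≤ 1`,
are nondegenerate at all points. Forms are encoded as continuous bilinear maps, so that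
nondegeneracy is the invertibility of a map from `E` to its dual. -/
structure MoserData (E : Type u) [NormedAddCommGroup E] [NormedSpace ℝ E] where
  /-- The constant form. -/
  B₀ : E →L[ℝ] E →L[ℝ] ℝ
  /-- The perturbation. -/
  τ : E → E →L[ℝ] E →L[ℝ] ℝ
  smooth : ContDiff ℝ ∞ τ
  alt₀ : ∀ v, B₀ v v = 0
  alt : ∀ x v, τ x v v = 0
  zero : τ 0 = 0
  invertible : ∀ s : ℝ, 0 ≤ s → s ≤ 1 → ∀ x, (B₀ + s • τ x).IsInvertible
  /-- The radius of a ball on which the perturbation is closed. -/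
  r : ℝ
  r_pos : 0 < r
  closed : ∀ x ∈ Metric.ball (0 : E) r, ∀ u v w,
    fderiv ℝ τ x u v w - fderiv ℝ τ x v u w + fderiv ℝ τ x w u v = 0

namespace MoserData

variable {E : Type u} [NormedAddCommGroup E] [NormedSpace ℝ E] (D : MoserData E)

/-- The form `B₀ + θ(t) τ` at time `t`, where `θ` is a smooth transition from `0` to `1`. -/
noncomputable def form (t : ℝ) (x : E) : E →L[ℝ] E →L[ℝ] ℝ :=
  D.B₀ + Real.smoothTransition t • D.τ x

/-- The time-dependent vector field `X` of the Moser argument, the solution of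
`ι_X (B₀ + θ τ) = - θ' σ`, where `σ` is the radial primitive of `τ`. -/
noncomputable def field (p : ℝ × E) : E :=
  -(deriv Real.smoothTransition p.1 • (D.form p.1 p.2).inverse (radialPrimitive D.τ p.2))

theorem form_isInvertible (t : ℝ) (x : E) : (D.form t x).IsInvertible :=
  D.invertible _ (Real.smoothTransition.nonneg t) (Real.smoothTransition.le_one t) x

theorem form_zero_time (x : E) : D.form 0 x = D.B₀ := by
  ext v w
  simp [form]

theorem form_one_time (x : E) : D.form 1 x = D.B₀ + D.τ x := by
  simp [form]

theorem form_self (t : ℝ) (x v : E) : D.form t x v v = 0 := by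
  simp [form, D.alt₀, D.alt]

theorem form_swap (t : ℝ) (x v w : E) : D.form t x v w = -D.form t x w v := by
  have h := D.form_self t x (v + w)
  simp only [map_add, add_apply, form_self] at h
  linarith

theorem form_field (t : ℝ) (x : E) :
    D.form t x (D.field (t, x)) = -(deriv Real.smoothTransition t • radialPrimitive D.τ x) := by
  rw [field, map_neg, map_smul, (D.form_isInvertible t x).self_apply_inverse]

theorem field_unique {t : ℝ} {x v : E}
    (h : D.form t x v = -(deriv Real.smoothTransition t • radialPrimitive D.τ x)) :
    v = D.field (t, x) := by
  rw [← D.form_field] at h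
  rw [← (D.form_isInvertible t x).inverse_apply_self v, h,
    (D.form_isInvertible t x).inverse_apply_self]

theorem contDiff_form : ContDiff ℝ ∞ (fun p : ℝ × E => D.form p.1 p.2) := by
  have h1 : ContDiff ℝ ∞ Real.smoothTransition := Real.smoothTransition.contDiff
  have h2 := D.smooth
  exact contDiff_const_add_smul (W := E →L[ℝ] E →L[ℝ] ℝ) D.B₀ (h1.comp contDiff_fst)
    (h2.comp contDiff_snd)

theorem contDiff_field [CompleteSpace E] : ContDiff ℝ ∞ D.field := by
  have h1 : ContDiff ℝ ∞ Real.smoothTransition := Real.smoothTransition.contDiff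
  have h2 : ContDiff ℝ ∞ (deriv Real.smoothTransition) :=
    (contDiff_infty_iff_deriv.1 h1).2
  have h3 : ContDiff ℝ ∞ (fun p : ℝ × E => (D.form p.1 p.2).inverse) := by
    rw [contDiff_iff_contDiffAt]
    intro p
    exact ((D.form_isInvertible p.1 p.2).contDiffAt_map_inverse (n := ∞)).comp p
      D.contDiff_form.contDiffAt
  exact ((h2.comp contDiff_fst).smul
    (h3.clm_apply ((contDiff_radialPrimitive D.smooth).comp contDiff_snd))).neg

theorem field_zero (t : ℝ) : D.field (t, 0) = 0 := by
  simp [field]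

/-- The derivative of the equation `ι_X (B₀ + θ τ) = - θ' σ` in a space direction. -/
theorem fderiv_form_field [CompleteSpace E] (t : ℝ) (x u w : E) :
    Real.smoothTransition t * fderiv ℝ D.τ x u (D.field (t, x)) w +
      D.form t x (fderiv ℝ D.field (t, x) (0, u)) w =
      -(deriv Real.smoothTransition t * fderiv ℝ (radialPrimitive D.τ) x u w) := by
  have hX : HasFDerivAt (fun y : E => D.field (t, y))
      ((fderiv ℝ D.field (t, x)).comp (ContinuousLinearMap.inr ℝ ℝ E)) x :=
    (D.contDiff_field.differentiable (by simp) (t, x)).hasFDerivAt.comp x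
      ((hasFDerivAt_const t x).prodMk (hasFDerivAt_id x))
  have hτ : HasFDerivAt (fun y : E => D.form t y)
      (Real.smoothTransition t • fderiv ℝ D.τ x) x :=
    hasFDerivAt_const_add_const_smul (W := E →L[ℝ] E →L[ℝ] ℝ) D.B₀ _
      (D.smooth.differentiable (by simp) x).hasFDerivAt
  have hσ : HasFDerivAt (fun y : E => -(deriv Real.smoothTransition t • radialPrimitive D.τ y))
      (-(deriv Real.smoothTransition t • fderiv ℝ (radialPrimitive D.τ) x)) x :=
    ((((contDiff_radialPrimitive D.smooth).differentiable (by simp) x).hasFDerivAt).const_smul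
      (deriv Real.smoothTransition t)).neg
  have h1 := hτ.clm_apply hX
  simp only [form_field] at h1
  have h2 := congrArg (fun A => A u w) (h1.unique hσ)
  simp at h2
  linarith

/-- The Moser field has no linear part at the origin, since `τ` vanishes there and hence `σ`
vanishes to second order. -/
theorem fderiv_field_zero [CompleteSpace E] (t : ℝ) (v : E) :
    fderiv ℝ D.field (t, 0) (0, v) = 0 := by
  have h : D.form t 0 (fderiv ℝ D.field (t, 0) (0, v)) = 0 := by
    ext w
    have h := D.fderiv_form_field t 0 v w
    rw [D.field_zero, fderiv_radialPrimitive_zero D.smooth D.zero] at h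
    simpa using h
  rw [← (D.form_isInvertible t 0).inverse_apply_self (fderiv ℝ D.field (t, 0) (0, v)), h, map_zero]

/-- Along an integral curve `Γ` of the Moser field, the value of the time-dependent form on two
solutions `Y`, `Z` of the linearised equation is constant. -/
theorem form_constant [CompleteSpace E] {Γ Y Z : ℝ → E}
    (hr : ∀ t ∈ Set.Icc (0 : ℝ) 1, Γ t ∈ Metric.ball (0 : E) D.r)
    (hΓ : ∀ t ∈ Set.Icc (0 : ℝ) 1, HasDerivAt Γ (D.field (t, Γ t)) t)
    (hY : ∀ t ∈ Set.Icc (0 : ℝ) 1, HasDerivAt Y (fderiv ℝ D.field (t, Γ t) (0, Y t)) t)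
    (hZ : ∀ t ∈ Set.Icc (0 : ℝ) 1, HasDerivAt Z (fderiv ℝ D.field (t, Γ t) (0, Z t)) t) :
    (D.B₀ + D.τ (Γ 1)) (Y 1) (Z 1) = D.B₀ (Y 0) (Z 0) := by
  have key : ∀ t ∈ Set.Icc (0 : ℝ) 1,
      HasDerivAt (fun t => D.form t (Γ t) (Y t) (Z t)) 0 t := by
    intro t ht
    have hθ : HasDerivAt Real.smoothTransition (deriv Real.smoothTransition t) t :=
      ((Real.smoothTransition.contDiff (n := 1)).differentiable (by simp) t).hasDerivAt
    have hform : HasDerivAt (fun t => D.form t (Γ t)) _ t :=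
      hasDerivAt_const_add_smul_comp (W := E →L[ℝ] E →L[ℝ] ℝ) D.B₀ hθ
        (D.smooth.differentiable (by simp) (Γ t)).hasFDerivAt (hΓ t ht)
    refine ((hform.clm_apply (hY t ht)).clm_apply (hZ t ht)).congr_deriv ?_
    -- The derivative vanishes by the equation of the field, differentiated in the directions `Y`
    -- and `Z`, together with `dσ = τ` and `dτ = 0`.
    have e1 := D.fderiv_form_field t (Γ t) (Y t) (Z t)
    have e2 := D.fderiv_form_field t (Γ t) (Z t) (Y t)
    have e3 := radialPrimitive_extDeriv D.smooth D.alt D.closed (hr t ht) (Y t) (Z t)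
    have e4 := D.closed (Γ t) (hr t ht) (D.field (t, Γ t)) (Y t) (Z t)
    rw [D.form_swap t (Γ t) _ (Y t)] at e2
    simp only [add_apply, smul_apply, smul_eq_mul]
    linear_combination e1 - e2 - deriv Real.smoothTransition t * e3 +
      Real.smoothTransition t * e4
  have hc := constant_of_has_deriv_right_zero
    (fun t ht => (key t ht).continuousAt.continuousWithinAt)
    (fun t ht => (key t (Set.Ico_subset_Icc_self ht)).hasDerivWithinAt) 1
    (Set.right_mem_Icc.2 zero_le_one)
  rwa [D.form_one_time, D.form_zero_time] at hc

/-- The radial primitive is natural under linear symmetries of the form, hence so is the Moser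
field. Surjectivity of the symmetry is needed to test forms on vectors `L w` only. -/
theorem field_equivariant {L : E →L[ℝ] E} (hL : Function.Surjective L)
    (h₀ : ∀ v w, D.B₀ (L v) (L w) = D.B₀ v w)
    (hτ : ∀ᶠ x in 𝓝 0, ∀ v w, D.τ (L x) (L v) (L w) = D.τ x v w) :
    ∃ ρ > 0, ∀ x ∈ Metric.ball (0 : E) ρ, ∀ t, D.field (t, L x) = L (D.field (t, x)) := by
  obtain ⟨ρ, hρ, hball⟩ := Metric.eventually_nhds_iff_ball.1 hτ
  refine ⟨ρ, hρ, fun x hx t => (D.field_unique ?_).symm⟩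
  ext w
  obtain ⟨w, rfl⟩ := hL w
  have h1 : D.form t (L x) (L (D.field (t, x))) (L w) = D.form t x (D.field (t, x)) w := by
    simp [form, h₀, hball x hx]
  have h2 : radialPrimitive D.τ (L x) (L w) = radialPrimitive D.τ x w := by
    rw [radialPrimitive_apply D.smooth.continuous, radialPrimitive_apply D.smooth.continuous]
    refine intervalIntegral.integral_congr fun s hs => ?_
    rw [Set.uIcc_of_le zero_le_one] at hs
    have hsx : s • x ∈ Metric.ball (0 : E) ρ := by
      rw [mem_ball_zero_iff] at hx ⊢
      rw [norm_smul, Real.norm_of_nonneg hs.1]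
      nlinarith [norm_nonneg x, hs.2]
    simp only [← map_smul, hball _ hsx]
  rw [h1, form_field]
  simp [h2]

end MoserData

theorem hasDerivAt_add_integral_IccExtend {E : Type*} [NormedAddCommGroup E] [NormedSpace ℝ E]
    [CompleteSpace E] (η : C(unitInterval, E)) (c : E) (t : ℝ) :
    HasDerivAt (fun t => c + ∫ s in (0 : ℝ)..t, Set.IccExtend zero_le_one η s)
      (Set.IccExtend zero_le_one η t) t :=
  (η.continuous.Icc_extend'.integral_hasStrictDerivAt 0 t).hasDerivAt.const_add c

namespace MoserData

variable {E : Type u} [NormedAddCommGroup E] [NormedSpace ℝ E] [CompleteSpace E] (D : MoserData E)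

/-- The Moser argument: the time-one map `ψ` of the Moser field pulls `B₀ + τ` back to `B₀`, and it
commutes with all linear symmetries of the form. -/
theorem exists_moser_map : ∃ ψ : E → E, ψ 0 = 0 ∧ (∀ᶠ x in 𝓝 0, ContDiffAt ℝ ∞ ψ x) ∧
    (∀ᶠ x in 𝓝 0, ∀ v w,
      (D.B₀ + D.τ (ψ x)) (fderiv ℝ ψ x v) (fderiv ℝ ψ x w) = D.B₀ v w) ∧
    ∀ L : E →L[ℝ] E, Function.Surjective L → (∀ v w, D.B₀ (L v) (L w) = D.B₀ v w) →
      (∀ᶠ x in 𝓝 0, ∀ v w, D.τ (L x) (L v) (L w) = D.τ x v w) →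
      ∀ᶠ x in 𝓝 0, ψ (L x) = L (ψ x) := by
  have hX := D.contDiff_field
  obtain ⟨Φ, hΦ0, hΦs, hΦP, hΦu⟩ := exists_smooth_flow hX D.field_zero D.fderiv_field_zero
  set ev : C(unitInterval, E) →L[ℝ] E := ContinuousMap.evalCLM ℝ (1 : unitInterval) with hev
  have hΦc : Filter.Tendsto Φ (𝓝 0) (𝓝 0) := by
    have := hΦs.self_of_nhds.continuousAt.tendsto
    rwa [hΦ0] at this
  have hsmall : ∀ ρ > 0, ∀ᶠ x in 𝓝 0, ∀ t, Φ x t ∈ Metric.ball (0 : E) ρ := by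
    intro ρ hρ
    filter_upwards [hΦc (Metric.ball_mem_nhds 0 hρ)] with x hx t
    rw [Set.mem_preimage, mem_ball_zero_iff] at hx
    exact mem_ball_zero_iff.2 (((Φ x).norm_coe_le_norm t).trans_lt hx)
  refine ⟨fun x => ev (Φ x), by simp [hΦ0], ?_, ?_, ?_⟩
  · filter_upwards [hΦs] with x hx
    exact ev.contDiff.contDiffAt.comp x hx
  · filter_upwards [hΦs, hΦP.eventually_nhds, hsmall D.r D.r_pos] with x hx hxP hxr v w
    have hxP' := hxP.self_of_nhds
    have hA : HasFDerivAt Φ (fderiv ℝ Φ x) x := (hx.differentiableAt (by simp)).hasFDerivAt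
    set A := fderiv ℝ Φ x with hAdef
    have hψ : ∀ u, fderiv ℝ (fun x => ev (Φ x)) x u = A u 1 := fun u =>
      congrArg (fun T => T u) (ev.hasFDerivAt.comp x hA).fderiv
    have hgraph : HasFDerivAt (fun y => (y, Φ y)) ((ContinuousLinearMap.id ℝ E).prod A) x :=
      (hasFDerivAt_id x).prodMk hA
    have hP : HasFDerivAt (fun y => picardMap D.field hX.continuous (y, Φ y)) _ x :=
      HasFDerivAt.comp (f := fun y => (y, Φ y)) x (hasFDerivAt_picardMap hX (x, Φ x)) hgraph
    have hAeq := (hA.congr_of_eventuallyEq (hxP.mono fun y hy => hy.symm)).unique hP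
    set N := nemytskii unitInterval D.field hX.continuous (graphCurve (Φ x)) with hN
    set M : E → C(unitInterval, E) := fun u => pointwiseApply unitInterval (ℝ × E) E
      (nemytskii unitInterval (fderiv ℝ D.field) (hX.continuous_fderiv (by simp))
        (graphCurve (Φ x)))
      ((ContinuousLinearMap.inr ℝ ℝ E).compLeftContinuous ℝ unitInterval (A u)) with hM
    -- The curve through `x` and the solutions of the linearised equation, extended to all times.
    set Γ : ℝ → E := fun t => x + ∫ s in (0 : ℝ)..t, Set.IccExtend zero_le_one N s with hΓ
    set Y : E → ℝ → E := fun u t => u + ∫ s in (0 : ℝ)..t, Set.IccExtend zero_le_one (M u) s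
      with hY
    have hΓI : ∀ t (ht : t ∈ Set.Icc (0 : ℝ) 1), Γ t = Φ x ⟨t, ht⟩ := fun t ht =>
      (congrArg (fun γ : C(unitInterval, E) => γ ⟨t, ht⟩) hxP').symm
    have hYI : ∀ u t (ht : t ∈ Set.Icc (0 : ℝ) 1), Y u t = A u ⟨t, ht⟩ := fun u t ht =>
      (congrArg (fun T : E →L[ℝ] C(unitInterval, E) => T u ⟨t, ht⟩) hAeq).symm
    have hΓ' : ∀ t ∈ Set.Icc (0 : ℝ) 1, HasDerivAt Γ (D.field (t, Γ t)) t := by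
      intro t ht
      have h := hasDerivAt_add_integral_IccExtend N x t
      rw [Set.IccExtend_of_mem _ _ ht] at h
      rw [hΓI t ht]
      exact h
    have hY' : ∀ u, ∀ t ∈ Set.Icc (0 : ℝ) 1,
        HasDerivAt (Y u) (fderiv ℝ D.field (t, Γ t) (0, Y u t)) t := by
      intro u t ht
      have h := hasDerivAt_add_integral_IccExtend (M u) u t
      rw [Set.IccExtend_of_mem _ _ ht] at h
      rw [hΓI t ht, hYI u t ht]
      exact h
    have hconst := D.form_constant (fun t ht => by rw [hΓI t ht]; exact hxr _) hΓ' (hY' v) (hY' w)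
    have h1 : (1 : ℝ) ∈ Set.Icc (0 : ℝ) 1 := Set.right_mem_Icc.2 zero_le_one
    rw [hΓI 1 h1, hYI v 1 h1, hYI w 1 h1] at hconst
    rw [hψ, hψ]
    refine hconst.trans ?_
    simp [hY]
  · intro L hL h₀ hτ
    obtain ⟨ρ, hρ, heq⟩ := D.field_equivariant hL h₀ hτ
    set LL := L.compLeftContinuous ℝ unitInterval with hLL
    have hlim : Filter.Tendsto (fun x => (L x, LL (Φ x))) (𝓝 0) (𝓝 0) := by
      have h1 : Filter.Tendsto L (𝓝 0) (𝓝 0) := L.continuous.tendsto' _ _ (map_zero L)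
      have h2 : Filter.Tendsto LL (𝓝 0) (𝓝 0) := LL.continuous.tendsto' _ _ (map_zero LL)
      exact h1.prodMk_nhds (h2.comp hΦc)
    filter_upwards [hlim.eventually hΦu, hsmall ρ hρ, hΦP] with x hx hxρ hxP
    -- The curve `L ∘ Φ x` is a fixed point of the Picard operator, starting at `L x`.
    refine (congrArg ev (hx ?_)).symm
    ext t
    have hxP' : Φ x t = x + ∫ s in (0 : ℝ)..t, Set.IccExtend zero_le_one
      (nemytskii unitInterval D.field hX.continuous (graphCurve (Φ x))) s :=
      congrArg (fun γ : C(unitInterval, E) => γ t) hxP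
    change L (Φ x t) = L x + ∫ s in (0 : ℝ)..t, Set.IccExtend zero_le_one
      (nemytskii unitInterval D.field hX.continuous (graphCurve (LL (Φ x)))) s
    rw [hxP', map_add, ← ContinuousLinearMap.intervalIntegral_comp_comm]
    · congr 1
      refine intervalIntegral.integral_congr fun s _ => ?_
      exact (heq _ (hxρ (Set.projIcc 0 1 zero_le_one s)) _).symm
    · exact (ContinuousMap.continuous _).Icc_extend'.intervalIntegrable _ _

end MoserData

/-! ### The equivariant Darboux theorem -/

/-- An alternating `2`-form as a bilinear form, linearly in the form. -/
noncomputable def alternatingToBilinear (E : Type*) [NormedAddCommGroup E] [NormedSpace ℝ E] :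
    (E [⋀^Fin 2]→L[ℝ] ℝ) →L[ℝ] (E →L[ℝ] E →L[ℝ] ℝ) :=
  (ContinuousLinearMap.compL ℝ E (E [⋀^Fin 1]→L[ℝ] ℝ) (E →L[ℝ] ℝ)
    ((ContinuousAlternatingMap.ofSubsingletonLIE (𝕜 := ℝ) (E := E) (F := ℝ)
      (ι := Fin 1) 0).symm.toContinuousLinearEquiv : _ →L[ℝ] _)).comp
    ContinuousAlternatingMap.curryLeftLI.toContinuousLinearMap

theorem alternatingToBilinear_apply {E : Type*} [NormedAddCommGroup E] [NormedSpace ℝ E]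
    (β : E [⋀^Fin 2]→L[ℝ] ℝ) (v w : E) : alternatingToBilinear E β v w = β ![v, w] := by
  change β (Matrix.vecCons v fun _ => w) = _
  congr 1
  ext i
  fin_cases i <;> rfl

theorem extDeriv_two_apply {E : Type*} [NormedAddCommGroup E] [NormedSpace ℝ E]
    (β : E → E [⋀^Fin 2]→L[ℝ] ℝ) (x u v w : E) :
    extDeriv β x ![u, v, w] =
      fderiv ℝ β x u ![v, w] - fderiv ℝ β x v ![u, w] + fderiv ℝ β x w ![u, v] := by
  rw [extDeriv, ContinuousAlternatingMap.alternatizeUncurryFin_apply, Fin.sum_univ_three]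
  have h0 : Fin.removeNth 0 ![u, v, w] = ![v, w] := by ext i; fin_cases i <;> rfl
  have h1 : Fin.removeNth 1 ![u, v, w] = ![u, w] := by ext i; fin_cases i <;> rfl
  have h2 : Fin.removeNth 2 ![u, v, w] = ![u, v] := by ext i; fin_cases i <;> rfl
  rw [h0, h1, h2]
  simp
  ring

/-- Cutting off the nonconstant part of a function which is smooth near the origin, so that its
values stay in a given neighbourhood `U` of its value at the origin. -/
theorem exists_cutoff {E W : Type*} [NormedAddCommGroup E] [NormedSpace ℝ E]
    [FiniteDimensional ℝ E] [NormedAddCommGroup W] [NormedSpace ℝ W] {B : E → W} {O : Set E}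
    (hO : IsOpen O) (h0 : 0 ∈ O) (hB : ContDiffOn ℝ ∞ B O) {U : Set W} (hU : IsOpen U)
    (h0U : B 0 ∈ U) :
    ∃ (τ : E → W) (r : ℝ), 0 < r ∧ Metric.ball 0 r ⊆ O ∧ ContDiff ℝ ∞ τ ∧ τ 0 = 0 ∧
      (∀ s : ℝ, 0 ≤ s → s ≤ 1 → ∀ x, B 0 + s • τ x ∈ U) ∧
      (∀ x ∈ Metric.ball 0 r, B 0 + τ x = B x) ∧
      (∀ x ∈ Metric.ball 0 r, fderiv ℝ τ x = fderiv ℝ B x) ∧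
      ∀ x, ∃ c : ℝ, τ x = c • (B x - B 0) := by
  obtain ⟨δ, hδ, hball⟩ := Metric.isOpen_iff.1 hU _ h0U
  have hcont : ContinuousAt B 0 := hB.continuousOn.continuousAt (hO.mem_nhds h0)
  obtain ⟨r, hr, hrO⟩ := Metric.eventually_nhds_iff_ball.1
    ((hO.eventually_mem h0).and (hcont (Metric.ball_mem_nhds _ hδ)))
  set χ : ContDiffBump (0 : E) := ⟨r / 3, r / 2, by positivity, by linarith⟩ with hχ
  have hin : ∀ x ∈ Metric.ball (0 : E) (r / 3), χ x • (B x - B 0) = B x - B 0 := by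
    intro x hx
    rw [χ.one_of_mem_closedBall (Metric.ball_subset_closedBall hx), one_smul]
  have hout : ∀ x, r / 2 ≤ dist x 0 → χ x • (B x - B 0) = 0 := by
    intro x hx
    rw [χ.zero_of_le_dist hx, zero_smul]
  refine ⟨fun x => χ x • (B x - B 0), r / 3, by positivity,
    fun x hx => (hrO x (Metric.ball_subset_ball (by linarith) hx)).1, ?_, ?_, ?_, ?_, ?_,
    fun x => ⟨χ x, rfl⟩⟩
  · rw [contDiff_iff_contDiffAt]
    intro x
    by_cases hx : x ∈ Metric.ball (0 : E) r
    · have h1 : ContDiffAt ℝ ∞ B x := hB.contDiffAt (hO.mem_nhds (hrO x hx).1)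
      exact χ.contDiffAt.smul (h1.sub contDiffAt_const)
    · have hmem : (Metric.closedBall (0 : E) (r / 2))ᶜ ∈ 𝓝 x := by
        refine Metric.isClosed_closedBall.isOpen_compl.mem_nhds fun h => hx ?_
        exact Metric.closedBall_subset_ball (by linarith) h
      refine (contDiffAt_const (c := (0 : W))).congr_of_eventuallyEq ?_
      filter_upwards [hmem] with y hy
      refine hout y (le_of_lt ?_)
      rw [Set.mem_compl_iff, Metric.mem_closedBall, not_le] at hy
      exact hy
  · simp
  · intro s hs0 hs1 x
    apply hball
    rw [mem_ball_iff_norm, add_sub_cancel_left]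
    by_cases hx : x ∈ Metric.ball (0 : E) r
    · have h1 : ‖B x - B 0‖ < δ := mem_ball_iff_norm.1 (hrO x hx).2
      rw [smul_smul, norm_smul, Real.norm_of_nonneg (mul_nonneg hs0 χ.nonneg)]
      have h3 : s * χ x ≤ 1 := mul_le_one₀ hs1 χ.nonneg χ.le_one
      nlinarith [norm_nonneg (B x - B 0), mul_nonneg hs0 (χ.nonneg (x := x))]
    · beta_reduce
      rw [Metric.mem_ball, not_lt] at hx
      rwa [hout x (by linarith), smul_zero, norm_zero]
  · intro x hx
    beta_reduce
    rw [hin x hx, add_sub_cancel]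
  · intro x hx
    have h : (fun x => χ x • (B x - B 0)) =ᶠ[𝓝 x] fun y => B y - B 0 := by
      filter_upwards [Metric.isOpen_ball.mem_nhds hx] with y hy using hin y hy
    rw [h.fderiv_eq, fderiv_sub_const]

/-- A closed form near the origin which is nondegenerate at the origin becomes, after cutting off
its nonconstant part, an input of the Moser argument. -/
theorem exists_moserData {E : Type u} [NormedAddCommGroup E] [NormedSpace ℝ E]
    [FiniteDimensional ℝ E] {β : E → E [⋀^Fin 2]→L[ℝ] ℝ} {O : Set E} (hO : IsOpen O)
    (h0 : 0 ∈ O) (hβ : ContDiffOn ℝ ∞ β O) (hcl : ∀ x ∈ O, extDeriv β x = 0)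
    (hnd : ∀ v, v ≠ 0 → ∃ w, β 0 ![v, w] ≠ 0) :
    ∃ D : MoserData E, D.B₀ = alternatingToBilinear E (β 0) ∧
      ∀ᶠ x in 𝓝 0, D.B₀ + D.τ x = alternatingToBilinear E (β x) := by
  set B : E → E →L[ℝ] E →L[ℝ] ℝ := fun x => alternatingToBilinear E (β x) with hB
  have hBs : ContDiffOn ℝ ∞ B O := by
    have h : ContDiff ℝ ∞ (alternatingToBilinear E) := by fun_prop
    exact h.comp_contDiffOn hβ
  have hBinv : (B 0).IsInvertible := by
    have hinj : Function.Injective (B 0).toLinearMap := by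
      rw [← LinearMap.ker_eq_bot, LinearMap.ker_eq_bot']
      intro v hv
      by_contra hne
      obtain ⟨w, hw⟩ := hnd v hne
      apply hw
      rw [← alternatingToBilinear_apply]
      exact congrArg (fun A : E →L[ℝ] ℝ => A w) hv
    have hdim : Module.finrank ℝ E = Module.finrank ℝ (E →L[ℝ] ℝ) := by
      rw [← (LinearMap.toContinuousLinearMap (𝕜 := ℝ) (E := E) (F' := ℝ)).finrank_eq]
      exact (Subspace.dual_finrank_eq (K := ℝ) (V := E)).symm
    refine ⟨(LinearEquiv.ofInjectiveOfFinrankEq (B 0).toLinearMap hinj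
      hdim).toContinuousLinearEquiv, ?_⟩
    ext v w
    rfl
  have hopen : IsOpen {A : E →L[ℝ] E →L[ℝ] ℝ | A.IsInvertible} :=
    ContinuousLinearEquiv.isOpen (𝕜 := ℝ) (E := E) (F := E →L[ℝ] ℝ)
  have halt : ∀ x v, B x v v = 0 := by
    intro x v
    rw [hB, alternatingToBilinear_apply]
    exact (β x).map_eq_zero_of_eq _ (i := 0) (j := 1) rfl (by decide)
  obtain ⟨τ, r, hr, hrO, hτs, hτ0, hτU, hτB, hτd, hτc⟩ :=
    exists_cutoff (W := E →L[ℝ] E →L[ℝ] ℝ) hO h0 hBs hopen hBinv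
  refine ⟨⟨B 0, τ, hτs, halt 0, ?_, hτ0, hτU, r, hr, ?_⟩, rfl, ?_⟩
  · intro x v
    obtain ⟨c, hc⟩ := hτc x
    rw [hc]
    simp [halt]
  · intro x hx u v w
    have hβd : HasFDerivAt β (fderiv ℝ β x) x :=
      ((hβ.contDiffAt (hO.mem_nhds (hrO hx))).differentiableAt (by simp)).hasFDerivAt
    have hBd : HasFDerivAt B ((alternatingToBilinear E).comp (fderiv ℝ β x)) x := by
      refine HasFDerivAt.comp (F := E [⋀^Fin 2]→L[ℝ] ℝ) (G := E →L[ℝ] E →L[ℝ] ℝ)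
        (g := fun A => alternatingToBilinear E A) (f := β) (g' := alternatingToBilinear E) x ?_ hβd
      apply ContinuousLinearMap.hasFDerivAt
    rw [hτd x hx, hBd.fderiv]
    simp only [ContinuousLinearMap.comp_apply, alternatingToBilinear_apply]
    rw [← extDeriv_two_apply, hcl x (hrO hx)]
    simp
  · filter_upwards [Metric.ball_mem_nhds (0 : E) hr] with x hx using hτB x hx

/-- The equivariant Darboux theorem: a symplectic form near the origin of a vector space has
constant coefficients in suitable coordinates, in which moreover its linear symmetries are the same
linear maps. -/
theorem exists_equivariant_darboux {E : Type u} [NormedAddCommGroup E] [NormedSpace ℝ E]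
    [FiniteDimensional ℝ E] {β : E → E [⋀^Fin 2]→L[ℝ] ℝ} {O : Set E} (hO : IsOpen O)
    (h0 : 0 ∈ O) (hβ : ContDiffOn ℝ ∞ β O) (hcl : ∀ x ∈ O, extDeriv β x = 0)
    (hnd : ∀ v, v ≠ 0 → ∃ w, β 0 ![v, w] ≠ 0) :
    ∃ e : OpenPartialHomeomorph E E, 0 ∈ e.source ∧ e 0 = 0 ∧ e.target ⊆ O ∧
      ContDiffOn ℝ ∞ e e.source ∧ ContDiffOn ℝ ∞ e.symm e.target ∧
      (∀ x ∈ e.source, (β (e x)).compContinuousLinearMap (fderiv ℝ e x) = β 0) ∧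
      ∀ L : E →L[ℝ] E, Function.Surjective L →
        (∀ᶠ x in 𝓝 0, (β (L x)).compContinuousLinearMap L = β x) →
        ∀ᶠ x in 𝓝 0, e (L x) = L (e x) := by
  have : CompleteSpace E := FiniteDimensional.complete ℝ E
  obtain ⟨D, hD0, hDτ⟩ := exists_moserData hO h0 hβ hcl hnd
  obtain ⟨ψ, hψ0, hψs, hψβ, hψL⟩ := D.exists_moser_map
  have hψc : Filter.Tendsto ψ (𝓝 0) (𝓝 0) := by
    have := hψs.self_of_nhds.continuousAt.tendsto
    rwa [hψ0] at this
  obtain ⟨S, hS, hSo, hS0⟩ := eventually_nhds_iff.1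
    (((hψs.and hψβ).and (hψc.eventually hDτ)).and (hψc.eventually (hO.eventually_mem h0)))
  have hinj : Function.Injective (fderiv ℝ ψ 0).toLinearMap := by
    rw [← LinearMap.ker_eq_bot, LinearMap.ker_eq_bot']
    intro v hv
    by_contra hne
    obtain ⟨w, hw⟩ := hnd v hne
    apply hw
    have h1 := (hS 0 hS0).1.1.2 v w
    have hv' : fderiv ℝ ψ 0 v = 0 := hv
    rw [hv', map_zero, hD0, alternatingToBilinear_apply] at h1
    simpa using h1.symm
  have hd : HasFDerivAt ψ (((LinearEquiv.ofInjectiveEndo (fderiv ℝ ψ 0).toLinearMap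
      hinj).toContinuousLinearEquiv : E ≃L[ℝ] E) : E →L[ℝ] E) 0 := by
    refine (((hS 0 hS0).1.1.1.differentiableAt (by simp)).hasFDerivAt).congr_fderiv ?_
    ext v
    rfl
  have hψS : ContDiffOn ℝ ∞ ψ S := fun x hx => (hS x hx).1.1.1.contDiffWithinAt
  obtain ⟨e, he, he0, heS, hes⟩ :=
    exists_openPartialHomeomorph_of_contDiffOn hSo hS0 hψS hd
  refine ⟨e, he0, by rw [he, hψ0], ?_, ?_, hes, ?_, ?_⟩
  · intro y hy
    have h1 := (hS _ (heS (e.map_target hy))).2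
    rwa [← he, e.right_inv hy] at h1
  · rw [he]
    exact hψS.mono heS
  · intro x hx
    obtain ⟨⟨⟨-, h1⟩, h2⟩, -⟩ := hS x (heS hx)
    rw [he]
    ext v
    have h3 := h1 (v 0) (v 1)
    rw [h2, hD0, alternatingToBilinear_apply, alternatingToBilinear_apply] at h3
    have h4 : v = ![v 0, v 1] := by ext i; fin_cases i <;> rfl
    rw [ContinuousAlternatingMap.compContinuousLinearMap_apply]
    have h5 : (fderiv ℝ ψ x) ∘ v = ![fderiv ℝ ψ x (v 0), fderiv ℝ ψ x (v 1)] := by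
      ext i; fin_cases i <;> rfl
    rw [h5, h3, ← h4]
  · intro L hL hLβ
    have hLb : ∀ᶠ x in 𝓝 0, ∀ v w, alternatingToBilinear E (β (L x)) (L v) (L w) =
        alternatingToBilinear E (β x) v w := by
      filter_upwards [hLβ] with x hx v w
      rw [alternatingToBilinear_apply, alternatingToBilinear_apply, ← hx,
        ContinuousAlternatingMap.compContinuousLinearMap_apply]
      congr 1
      ext i; fin_cases i <;> rfl
    have hL0 : ∀ v w, D.B₀ (L v) (L w) = D.B₀ v w := by
      intro v w
      have := hLb.self_of_nhds v w
      rwa [map_zero, ← hD0] at this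
    rw [he]
    refine hψL L hL hL0 ?_
    have hLc : Filter.Tendsto L (𝓝 0) (𝓝 0) := L.continuous.tendsto' _ _ (map_zero L)
    filter_upwards [hLb, hDτ, hLc.eventually hDτ] with x h1 h2 h3 v w
    have h4 := h1 v w
    rw [← h2, ← h3] at h4
    simpa [hL0] using h4

/-! ### Unitary coordinates on symplectic representations -/

open scoped RealInnerProductSpace

section ComplexStructure

variable {V : Type*} [NormedAddCommGroup V] [InnerProductSpace ℝ V] [FiniteDimensional ℝ V]

/-- The orthogonal part `J = A |A|⁻¹` of an invertible skew-symmetric endomorphism `A` is a complex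
structure, which commutes with everything that commutes with `A`. -/
theorem exists_complexStructure_of_skew (A : V →ₗ[ℝ] V) (hskew : ∀ v w, ⟪A v, w⟫ = -⟪v, A w⟫)
    (hinj : ∀ v, A v = 0 → v = 0) :
    ∃ J : V →ₗ[ℝ] V, (∀ v, J (J v) = -v) ∧ (∀ v w, ⟪J v, w⟫ = -⟪v, J w⟫) ∧
      (∀ v, v ≠ 0 → 0 < ⟪A v, J v⟫) ∧
      ∀ M : V →ₗ[ℝ] V, (∀ v, M (A v) = A (M v)) → ∀ v, M (J v) = J (M v) := by
  set S : V →ₗ[ℝ] V := -(A ∘ₗ A) with hS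
  have hSapp : ∀ v, S v = -A (A v) := fun v => rfl
  have hSsymm : S.IsSymmetric := by
    intro v w
    rw [hSapp, hSapp, inner_neg_left, inner_neg_right, hskew, hskew v, neg_neg]
  set b := hSsymm.eigenvectorBasis rfl with hb
  set μ := hSsymm.eigenvalues rfl with hμ
  have hSb : ∀ i, S (b i) = μ i • b i := fun i => hSsymm.apply_eigenvectorBasis rfl i
  have hinner : ∀ v w, ⟪S v, w⟫ = ⟪A v, A w⟫ := by
    intro v w
    rw [hSapp, inner_neg_left, hskew, neg_neg]
  have hμpos : ∀ i, 0 < μ i := by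
    intro i
    have h1 : μ i = ⟪A (b i), A (b i)⟫ := by
      rw [← hinner, hSb, real_inner_smul_left, real_inner_self_eq_norm_sq, b.orthonormal.1]
      simp
    rw [h1]
    refine real_inner_self_nonneg.lt_of_ne' fun h => ?_
    have h2 := hinj _ (inner_self_eq_zero.1 h)
    have h3 := b.orthonormal.1 i
    rw [h2, norm_zero] at h3
    exact zero_ne_one h3
  -- `Q` is the inverse square root of `S = -A²`.
  set Q : V →ₗ[ℝ] V := ∑ i, (√(μ i))⁻¹ • (innerₛₗ ℝ (b i)).smulRight (b i) with hQ
  have hQapp : ∀ v, Q v = ∑ i, ((√(μ i))⁻¹ * ⟪b i, v⟫) • b i := by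
    intro v
    simp [hQ, smul_smul]
  have hQeigen : ∀ v c, S v = c • v → Q v = (√c)⁻¹ • v := by
    intro v c hv
    rw [hQapp]
    conv_rhs => rw [← b.sum_repr' v, Finset.smul_sum]
    refine Finset.sum_congr rfl fun i _ => ?_
    rw [smul_smul]
    congr 1
    by_cases h : ⟪b i, v⟫ = 0
    · simp [h]
    · have h1 : μ i * ⟪b i, v⟫ = c * ⟪b i, v⟫ := by
        rw [← real_inner_smul_left, ← hSb, hSsymm, hv, real_inner_smul_right]
      rw [mul_right_cancel₀ h h1]
  have hQcomm : ∀ M : V →ₗ[ℝ] V, (∀ v, M (A v) = A (M v)) → ∀ v, M (Q v) = Q (M v) := by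
    intro M hM v
    have h : M ∘ₗ Q = Q ∘ₗ M := by
      refine b.toBasis.ext fun i => ?_
      simp only [LinearMap.comp_apply, b.coe_toBasis]
      rw [hQeigen _ _ (hSb i), hQeigen (M (b i)) (μ i), map_smul]
      rw [hSapp, ← hM, ← hM, ← map_neg, ← hSapp, hSb, map_smul]
    exact congrArg (fun T : V →ₗ[ℝ] V => T v) h
  have hQA := hQcomm A fun _ => rfl
  have hQsymm : ∀ v w, ⟪Q v, w⟫ = ⟪v, Q w⟫ := by
    intro v w
    rw [hQapp, hQapp, sum_inner, inner_sum]
    refine Finset.sum_congr rfl fun i _ => ?_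
    rw [real_inner_smul_left, real_inner_smul_right, real_inner_comm v (b i)]
    ring
  have hQQ : ∀ v, S (Q (Q v)) = v := by
    intro v
    have h : S ∘ₗ Q ∘ₗ Q = LinearMap.id := by
      refine b.toBasis.ext fun i => ?_
      simp only [LinearMap.comp_apply, b.coe_toBasis, LinearMap.id_apply]
      rw [hQeigen _ _ (hSb i), map_smul, hQeigen _ _ (hSb i), map_smul, map_smul, hSb, smul_smul,
        smul_smul]
      have h1 : √(μ i) * √(μ i) = μ i := Real.mul_self_sqrt (hμpos i).le
      have h2 : √(μ i) ≠ 0 := (Real.sqrt_pos.2 (hμpos i)).ne'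
      have h3 : (√(μ i))⁻¹ * ((√(μ i))⁻¹ * μ i) = 1 := by
        rw [← h1]
        field_simp
        rw [Real.sqrt_sq (Real.sqrt_nonneg _)]
      rw [mul_assoc, h3, one_smul]
    exact congrArg (fun T : V →ₗ[ℝ] V => T v) h
  refine ⟨A ∘ₗ Q, ?_, ?_, ?_, ?_⟩
  · intro v
    simp only [LinearMap.comp_apply]
    rw [← hQA, ← neg_inj, ← hSapp, hQQ, neg_neg]
  · intro v w
    simp only [LinearMap.comp_apply]
    rw [hskew, hQsymm, ← hQA]
  · intro v hv
    simp only [LinearMap.comp_apply]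
    rw [← hinner, hQapp, inner_sum]
    have hterm : ∀ i, ⟪S v, ((√(μ i))⁻¹ * ⟪b i, v⟫) • b i⟫ =
        (√(μ i))⁻¹ * μ i * ⟪b i, v⟫ ^ 2 := by
      intro i
      rw [real_inner_smul_right, hSsymm, hSb, real_inner_smul_right, real_inner_comm v (b i)]
      ring
    have hpos : ∀ i, 0 < (√(μ i))⁻¹ * μ i := fun i =>
      mul_pos (inv_pos.2 (Real.sqrt_pos.2 (hμpos i))) (hμpos i)
    simp only [hterm]
    refine Finset.sum_pos' (fun i _ => mul_nonneg (hpos i).le (sq_nonneg _)) ?_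
    by_contra! h
    apply hv
    rw [← b.sum_repr' v]
    refine Finset.sum_eq_zero fun i hi => ?_
    have h1 := h i hi
    have h2 : ⟪b i, v⟫ ^ 2 = 0 := by
      nlinarith [hpos i, sq_nonneg ⟪b i, v⟫, mul_nonneg (hpos i).le (sq_nonneg ⟪b i, v⟫)]
    rw [pow_eq_zero_iff two_ne_zero |>.1 h2, zero_smul]
  · intro M hM v
    simp only [LinearMap.comp_apply]
    rw [hM, hQcomm M hM]

end ComplexStructure

section Invariant

variable {V : Type*} [AddCommGroup V] [Module ℝ V] [FiniteDimensional ℝ V]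

/-- The inner product which is obtained by averaging the standard one in some basis over a finite
group. -/
noncomputable abbrev averagedCore {G : Type*} [Group G] [Fintype G] (ρ : G →* Module.End ℝ V) :
    InnerProductSpace.Core ℝ V where
  inner v w := ∑ g, ∑ i, (Module.finBasis ℝ V).repr (ρ g v) i * (Module.finBasis ℝ V).repr (ρ g w) i
  conj_inner_symm v w := by
    simp [mul_comm]
  re_inner_nonneg v := by
    simp only [RCLike.re_to_real]
    exact Finset.sum_nonneg fun g _ => Finset.sum_nonneg fun i _ => mul_self_nonneg _
  add_left u v w := by
    simp [add_mul, Finset.sum_add_distrib]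
  smul_left v w c := by
    simp [Finset.mul_sum, mul_assoc]
  definite v hv := by
    have h1 := (Finset.sum_eq_zero_iff_of_nonneg
      (fun g _ => Finset.sum_nonneg fun i _ => mul_self_nonneg _)).1 hv 1 (Finset.mem_univ _)
    have h2 := (Finset.sum_eq_zero_iff_of_nonneg fun i _ => mul_self_nonneg _).1 h1
    simp only [map_one, Module.End.one_apply] at h2
    refine (Module.finBasis ℝ V).repr.map_eq_zero_iff.1 (Finsupp.ext fun i => ?_)
    exact mul_self_eq_zero.1 (h2 i (Finset.mem_univ _))

/-- A symplectic vector space with a finite group of symmetries has an invariant compatible complex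
structure. -/
theorem exists_invariant_complexStructure {G : Type*} [Group G] [Finite G]
    (ρ : G →* Module.End ℝ V) (β : V →ₗ[ℝ] V →ₗ[ℝ] ℝ) (halt : ∀ v, β v v = 0)
    (hnd : ∀ v, v ≠ 0 → ∃ w, β v w ≠ 0) (hinv : ∀ g v w, β (ρ g v) (ρ g w) = β v w) :
    ∃ J : V →ₗ[ℝ] V, (∀ v, J (J v) = -v) ∧ (∀ v w, β (J v) (J w) = β v w) ∧
      (∀ v, v ≠ 0 → 0 < β v (J v)) ∧ ∀ g v, ρ g (J v) = J (ρ g v) := by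
  have := Fintype.ofFinite G
  let core : InnerProductSpace.Core ℝ V := averagedCore ρ
  let : NormedAddCommGroup V := core.toNormedAddCommGroup
  let : InnerProductSpace ℝ V := InnerProductSpace.ofCore core.toCore
  have hiso : ∀ h v w, ⟪ρ h v, ρ h w⟫ = ⟪v, w⟫ := by
    intro h v w
    change (∑ g, ∑ i, (Module.finBasis ℝ V).repr (ρ g (ρ h v)) i *
      (Module.finBasis ℝ V).repr (ρ g (ρ h w)) i) =
      ∑ g, ∑ i, (Module.finBasis ℝ V).repr (ρ g v) i * (Module.finBasis ℝ V).repr (ρ g w) i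
    refine Fintype.sum_equiv (Equiv.mulRight h) _ _ fun g => ?_
    simp [map_mul]
  have : CompleteSpace V := FiniteDimensional.complete ℝ V
  have hinvol : ∀ g v, ρ g (ρ g⁻¹ v) = v := by
    intro g v
    rw [← Module.End.mul_apply, ← map_mul, mul_inv_cancel, map_one, Module.End.one_apply]
  have hAex : ∀ v, ∃ a : V, ∀ w, ⟪a, w⟫ = β v w := fun v =>
    ⟨(InnerProductSpace.toDual ℝ V).symm (LinearMap.toContinuousLinearMap (β v)),
      fun w => InnerProductSpace.toDual_symm_apply⟩
  choose a ha using hAex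
  set A : V →ₗ[ℝ] V :=
    { toFun := a
      map_add' := fun v w => ext_inner_right ℝ fun u => by
        rw [ha, inner_add_left, ha, ha, map_add, LinearMap.add_apply]
      map_smul' := fun c v => ext_inner_right ℝ fun u => by
        rw [ha, RingHom.id_apply, real_inner_smul_left, ha, map_smul, LinearMap.smul_apply,
          smul_eq_mul] } with hA
  have hAβ : ∀ v w, ⟪A v, w⟫ = β v w := ha
  have hswap : ∀ v w, β v w = -β w v := by
    intro v w
    have h := halt (v + w)
    simp only [map_add, LinearMap.add_apply, halt] at h
    linarith
  have hskew : ∀ v w, ⟪A v, w⟫ = -⟪v, A w⟫ := by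
    intro v w
    rw [real_inner_comm, real_inner_comm (A w), real_inner_comm (A v), hAβ, hAβ, hswap]
  obtain ⟨J, hJJ, hJskew, hJpos, hJcomm⟩ := exists_complexStructure_of_skew A hskew (by
    intro v hv
    by_contra hne
    obtain ⟨w, hw⟩ := hnd v hne
    exact hw (by rw [← hAβ, hv, inner_zero_left]))
  refine ⟨J, hJJ, ?_, ?_, ?_⟩
  · intro v w
    rw [← hAβ, ← hAβ, hJcomm A fun _ => rfl, hJskew, hJJ, inner_neg_right, neg_neg]
  · intro v hv
    rw [← hAβ]
    exact hJpos v hv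
  · intro g v
    refine hJcomm (ρ g) (fun v => ext_inner_right ℝ fun w => ?_) v
    rw [hAβ]
    conv_lhs => rw [← hinvol g w]
    conv_rhs => rw [← hinvol g w]
    rw [hiso, hAβ, hinv]

/-- Unitary frames: a compatible complex structure has a basis over the complex numbers which is a
symplectic basis. -/
theorem exists_unitary_frame {n : ℕ} (hdim : Module.finrank ℝ V = 2 * n)
    (β : V →ₗ[ℝ] V →ₗ[ℝ] ℝ) (halt : ∀ v, β v v = 0) (J : V →ₗ[ℝ] V) (hJJ : ∀ v, J (J v) = -v)
    (hJβ : ∀ v w, β (J v) (J w) = β v w) (hpos : ∀ v, v ≠ 0 → 0 < β v (J v)) :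
    ∃ e : Fin n → V, (∀ i j, β (e i) (e j) = 0) ∧
      ∀ i j, β (e i) (J (e j)) = if i = j then 1 else 0 := by
  have hswap : ∀ v w, β v w = -β w v := by
    intro v w
    have h := halt (v + w)
    simp only [map_add, LinearMap.add_apply, halt] at h
    linarith
  have hsymm : ∀ v w, β v (J w) = β w (J v) := by
    intro v w
    rw [← hJβ, hJJ, map_neg, hswap, neg_neg]
  have step : ∀ k ≤ n, ∃ e : Fin k → V, (∀ i j, β (e i) (e j) = 0) ∧
      ∀ i j, β (e i) (J (e j)) = if i = j then 1 else 0 := by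
    intro k
    induction k with
    | zero => exact fun _ => ⟨Fin.elim0, fun i => i.elim0, fun i => i.elim0⟩
    | succ k ih =>
      intro hk
      obtain ⟨e, he1, he2⟩ := ih (by omega)
      -- A nonzero vector orthogonal to the frame exists since `2 k` is less than the dimension.
      set F : V →ₗ[ℝ] (Fin k → ℝ) × (Fin k → ℝ) :=
        (LinearMap.pi fun i => β (e i)).prod (LinearMap.pi fun i => β (J (e i))) with hF
      have hker : LinearMap.ker F ≠ ⊥ := by
        apply LinearMap.ker_ne_bot_of_finrank_lt
        rw [hdim, Module.finrank_prod, Module.finrank_fin_fun]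
        omega
      obtain ⟨u, hu, hu0⟩ := (Submodule.ne_bot_iff _).1 hker
      have hu1 : ∀ i, β (e i) u = 0 := fun i => congrFun (congrArg Prod.fst hu) i
      have hu2 : ∀ i, β (J (e i)) u = 0 := fun i => congrFun (congrArg Prod.snd hu) i
      have hc := hpos u hu0
      set c := (√(β u (J u)))⁻¹ with hcdef
      have hcc : c * (c * β u (J u)) = 1 := by
        have h1 := Real.mul_self_sqrt hc.le
        have h2 : √(β u (J u)) ≠ 0 := (Real.sqrt_pos.2 hc).ne'
        rw [hcdef]
        field_simp
        rw [pow_two]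
        exact h1.symm
      have hu3 : ∀ i, β (e i) (J u) = 0 := by
        intro i
        rw [← hJβ, hJJ, map_neg, hu2, neg_zero]
      refine ⟨Fin.snoc e (c • u), ?_, ?_⟩
      · intro i j
        refine Fin.lastCases ?_ (fun i => ?_) i
        · refine Fin.lastCases ?_ (fun j => ?_) j
          · simp [halt]
          · simp [hswap u, hu1]
        · refine Fin.lastCases ?_ (fun j => ?_) j
          · simp [hu1]
          · simp [he1]
      · intro i j
        refine Fin.lastCases ?_ (fun i => ?_) i
        · refine Fin.lastCases ?_ (fun j => ?_) j
          · simp [hcc]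
          · simp [hsymm u, hu3, (Fin.castSucc_lt_last j).ne']
        · refine Fin.lastCases ?_ (fun j => ?_) j
          · simp [hu3, (Fin.castSucc_lt_last i).ne]
          · simp [he2]
  exact step n le_rfl

/-- Linear symplectic coordinates in which a finite group of linear symmetries of a symplectic
vector space is unitary. -/
theorem exists_unitary_coordinates {n : ℕ} (hdim : Module.finrank ℝ V = 2 * n) {G : Type*}
    [Group G] [Finite G] (ρ : G →* Module.End ℝ V) (hρ : Function.Injective ρ)
    (β : V →ₗ[ℝ] V →ₗ[ℝ] ℝ) (halt : ∀ v, β v v = 0) (hnd : ∀ v, v ≠ 0 → ∃ w, β v w ≠ 0)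
    (hinv : ∀ g v w, β (ρ g v) (ρ g w) = β v w) :
    ∃ T : (Fin n → ℂ) ≃ₗ[ℝ] V,
      (∀ z w, β (T z) (T w) = ∑ i, ((z i).re * (w i).im - (z i).im * (w i).re)) ∧
      ∃ r : G →* Matrix.unitaryGroup (Fin n) ℂ, Function.Injective r ∧
        ∀ g z, ρ g (T z) = T ((r g : Matrix (Fin n) (Fin n) ℂ).mulVec z) := by
  obtain ⟨J, hJJ, hJβ, hpos, hJρ⟩ := exists_invariant_complexStructure ρ β halt hnd hinv
  obtain ⟨e, he1, he2⟩ := exists_unitary_frame hdim β halt J hJJ hJβ hpos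
  have hswap : ∀ v w, β v w = -β w v := by
    intro v w
    have h := halt (v + w)
    simp only [map_add, LinearMap.add_apply, halt] at h
    linarith
  set T₀ : (Fin n → ℂ) →ₗ[ℝ] V :=
    { toFun := fun z => ∑ i, ((z i).re • e i + (z i).im • J (e i))
      map_add' := fun z w => by
        rw [← Finset.sum_add_distrib]
        refine Finset.sum_congr rfl fun i _ => ?_
        simp only [Pi.add_apply, Complex.add_re, Complex.add_im, add_smul]
        abel
      map_smul' := fun c z => by
        simp [Finset.smul_sum, smul_smul] } with hT₀
  have hT₀app : ∀ z, T₀ z = ∑ i, ((z i).re • e i + (z i).im • J (e i)) := fun _ => rfl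
  have hJe : ∀ i j, β (J (e i)) (e j) = if i = j then -1 else 0 := by
    intro i j
    rw [hswap, he2]
    by_cases h : i = j
    · simp [h]
    · simp [h, Ne.symm h]
  have hT₀β : ∀ z w, β (T₀ z) (T₀ w) = ∑ i, ((z i).re * (w i).im - (z i).im * (w i).re) := by
    intro z w
    rw [hT₀app, hT₀app, map_sum]
    refine Finset.sum_congr rfl fun i _ => ?_
    simp [map_sum, LinearMap.sum_apply, he1, he2, hJβ, hJe, Finset.sum_add_distrib]
    ring
  have hT₀J : ∀ z, T₀ (Complex.I • z) = J (T₀ z) := by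
    intro z
    rw [hT₀app, hT₀app, map_sum]
    refine Finset.sum_congr rfl fun i _ => ?_
    simp [hJJ]
    abel
  have hinj : Function.Injective T₀ := by
    rw [← LinearMap.ker_eq_bot, LinearMap.ker_eq_bot']
    intro z hz
    have h := hT₀β z (Complex.I • z)
    rw [hz, map_zero, LinearMap.zero_apply] at h
    have h' : ∑ i, Complex.normSq (z i) = 0 := by
      rw [h]
      refine Finset.sum_congr rfl fun i _ => ?_
      simp [Complex.normSq_apply]
    ext i
    exact Complex.normSq_eq_zero.1
      ((Finset.sum_eq_zero_iff_of_nonneg fun i _ => Complex.normSq_nonneg _).1 h' i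
        (Finset.mem_univ i))
  have hfin : Module.finrank ℝ (Fin n → ℂ) = Module.finrank ℝ V := by
    rw [hdim, Module.finrank_pi_fintype]
    simp [mul_comm]
  set T := LinearEquiv.ofInjectiveOfFinrankEq T₀ hinj hfin with hT
  have hTapp : ∀ z, T z = T₀ z := fun _ => rfl
  have hTβ : ∀ z w, β (T z) (T w) = ∑ i, ((z i).re * (w i).im - (z i).im * (w i).re) := hT₀β
  have hTJ : ∀ z, T (Complex.I • z) = J (T z) := hT₀J
  -- In the coordinates `T`, the complex structure `J` is multiplication by `I`.
  set U : G → (Fin n → ℂ) →ₗ[ℂ] (Fin n → ℂ) := fun g =>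
    { toFun := fun z => T.symm (ρ g (T z))
      map_add' := fun z w => by simp
      map_smul' := fun c z => by
        apply T.injective
        have hc : ∀ y : Fin n → ℂ, T (c • y) = c.re • T y + c.im • J (T y) := by
          intro y
          rw [← hTJ, ← map_smul, ← map_smul, ← map_add]
          congr 1
          ext i
          simp only [Pi.smul_apply, Pi.add_apply, smul_eq_mul, Complex.real_smul]
          conv_lhs => rw [← Complex.re_add_im c]
          ring
        rw [RingHom.id_apply, LinearEquiv.apply_symm_apply, hc, hc, LinearEquiv.apply_symm_apply]
        simp [hJρ] } with hU
  have hUapp : ∀ g z, T (U g z) = ρ g (T z) := fun g z => T.apply_symm_apply _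
  have hUβ : ∀ g (z w : Fin n → ℂ), star (U g z) ⬝ᵥ U g w = star z ⬝ᵥ w := by
    intro g z w
    -- The Hermitian inner product is expressed by the form and multiplication by `I`.
    have hform : ∀ y x : Fin n → ℂ, star y ⬝ᵥ x =
        ⟨β (T y) (T (Complex.I • x)), β (T y) (T x)⟩ := by
      intro y x
      rw [hTβ, hTβ]
      apply Complex.ext
      · simp [dotProduct, Complex.re_sum]
      · simp [dotProduct, Complex.im_sum, sub_eq_add_neg]
    rw [hform, hform, ← map_smul, hUapp, hUapp, hUapp, hinv, hinv]
  have hUunit : ∀ g, LinearMap.toMatrix' (U g) ∈ Matrix.unitaryGroup (Fin n) ℂ := by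
    intro g
    rw [Matrix.mem_unitaryGroup_iff']
    ext i j
    have h := hUβ g (Pi.single i 1) (Pi.single j 1)
    have h1 : (star (LinearMap.toMatrix' (U g)) * LinearMap.toMatrix' (U g)) i j =
        star (U g (Pi.single i 1)) ⬝ᵥ U g (Pi.single j 1) := by
      simp [Matrix.mul_apply, dotProduct, LinearMap.toMatrix'_apply, Matrix.star_apply]
    rw [h1, h, Matrix.one_apply]
    simp [Pi.single_apply, eq_comm]
  refine ⟨T, hTβ,
    { toFun := fun g => ⟨LinearMap.toMatrix' (U g), hUunit g⟩
      map_one' := ?_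
      map_mul' := fun g h => ?_ }, ?_, ?_⟩
  · apply Subtype.ext
    change LinearMap.toMatrix' (U 1) = 1
    have : U 1 = LinearMap.id := by
      refine LinearMap.ext fun z => T.injective ?_
      rw [hUapp, map_one]
      rfl
    rw [this, LinearMap.toMatrix'_id]
  · apply Subtype.ext
    change LinearMap.toMatrix' (U (g * h)) = LinearMap.toMatrix' (U g) * LinearMap.toMatrix' (U h)
    rw [← LinearMap.toMatrix'_comp]
    congr 1
    refine LinearMap.ext fun z => T.injective ?_
    rw [hUapp, LinearMap.comp_apply, hUapp, hUapp, map_mul]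
    rfl
  · intro g h hgh
    have h1 : U g = U h := LinearMap.toMatrix'.injective (congrArg Subtype.val hgh)
    apply hρ
    refine LinearMap.ext fun v => ?_
    obtain ⟨z, rfl⟩ := T.surjective v
    rw [← hUapp, ← hUapp, h1]
  · intro g z
    change _ = T ((LinearMap.toMatrix' (U g)).mulVec z)
    rw [LinearMap.toMatrix'_mulVec, hUapp]

end Invariant

/-! ### Isotropy and rigidity in orbifold charts -/

theorem eventually_ne_of_continuousAt {Y Z : Type*} [TopologicalSpace Y] [TopologicalSpace Z]
    [T2Space Z] {f g : Y → Z} {x : Y} (hf : ContinuousAt f x) (hg : ContinuousAt g x)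
    (hne : f x ≠ g x) : ∀ᶠ y in 𝓝 x, f y ≠ g y :=
  (hf.prodMk hg).eventually (isClosed_diagonal.isOpen_compl.mem_nhds hne)

namespace OrbifoldChart

variable {X : Type*} [TopologicalSpace X] {m : ℕ} (c : OrbifoldChart X m)

theorem act_contDiffAt (γ : c.Γ) {x : EuclideanSpace ℝ (Fin m)} (hx : x ∈ c.U) :
    ContDiffAt ℝ ∞ (c.act γ) x :=
  (c.act_smooth γ).contDiffAt (c.isOpen_U.mem_nhds hx)

theorem act_hasFDerivAt (γ : c.Γ) {x : EuclideanSpace ℝ (Fin m)} (hx : x ∈ c.U) :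
    HasFDerivAt (c.act γ) (fderiv ℝ (c.act γ) x) x :=
  ((c.act_contDiffAt γ hx).differentiableAt (by simp)).hasFDerivAt

theorem act_inv_act (γ : c.Γ) {x : EuclideanSpace ℝ (Fin m)} (hx : x ∈ c.U) :
    c.act γ⁻¹ (c.act γ x) = x := by
  rw [← c.act_mul _ _ x hx, inv_mul_cancel, c.act_one x hx]

theorem act_act_inv (γ : c.Γ) {x : EuclideanSpace ℝ (Fin m)} (hx : x ∈ c.U) :
    c.act γ (c.act γ⁻¹ x) = x := by
  rw [← c.act_mul _ _ x hx, mul_inv_cancel, c.act_one x hx]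

theorem φ_act (γ : c.Γ) {x : EuclideanSpace ℝ (Fin m)} (hx : x ∈ c.U) :
    c.φ (c.act γ x) = c.φ x :=
  ((c.φ_eq_iff x hx _ (c.act_mem γ x hx)).2 ⟨γ, rfl⟩).symm

/-- The stabilizer of a point in the local group of a chart. -/
def stabilizer {u : EuclideanSpace ℝ (Fin m)} (hu : u ∈ c.U) : Subgroup c.Γ where
  carrier := {γ | c.act γ u = u}
  one_mem' := c.act_one u hu
  mul_mem' := fun {γ δ} hγ hδ => by
    rw [Set.mem_ofPred_eq] at *
    rw [c.act_mul γ δ u hu, hδ, hγ]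
  inv_mem' := fun {γ} hγ => by
    rw [Set.mem_ofPred_eq] at *
    conv_lhs => rw [← hγ]
    exact c.act_inv_act γ hu

/-- The isotropy representation of the stabilizer of a point on the tangent space. -/
noncomputable def isotropyRep {u : EuclideanSpace ℝ (Fin m)} (hu : u ∈ c.U) :
    c.stabilizer hu →* (EuclideanSpace ℝ (Fin m) →L[ℝ] EuclideanSpace ℝ (Fin m)) where
  toFun γ := fderiv ℝ (c.act γ) u
  map_one' := by
    have h : c.act ((1 : c.stabilizer hu) : c.Γ) =ᶠ[𝓝 u] id := by
      filter_upwards [c.isOpen_U.mem_nhds hu] with x hx using c.act_one x hx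
    rw [h.fderiv_eq, fderiv_id]
    rfl
  map_mul' γ δ := by
    have h : c.act ((γ * δ : c.stabilizer hu) : c.Γ) =ᶠ[𝓝 u] c.act γ ∘ c.act δ := by
      filter_upwards [c.isOpen_U.mem_nhds hu] with x hx using c.act_mul _ _ x hx
    rw [h.fderiv_eq]
    have hδ : c.act δ u = u := δ.2
    have hγ := c.act_hasFDerivAt (γ : c.Γ) hu
    have h2 : HasFDerivAt (c.act γ) (fderiv ℝ (c.act γ) u) (c.act δ u) := by rwa [hδ]
    exact (h2.comp u (c.act_hasFDerivAt δ hu)).fderiv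

theorem isotropyRep_apply {u : EuclideanSpace ℝ (Fin m)} (hu : u ∈ c.U) (γ : c.stabilizer hu) :
    c.isotropyRep hu γ = fderiv ℝ (c.act γ) u := rfl

/-- Bochner linearization: averaging over the stabilizer of `u` gives a map, tangent to the identity
at `u`, which intertwines the action of the stabilizer with its isotropy representation. -/
theorem exists_bochner_linearization {u : EuclideanSpace ℝ (Fin m)} (hu : u ∈ c.U) :
    ∃ h : EuclideanSpace ℝ (Fin m) → EuclideanSpace ℝ (Fin m), ContDiffOn ℝ ∞ h c.U ∧ h u = 0 ∧
      HasFDerivAt h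
        ((ContinuousLinearEquiv.refl ℝ (EuclideanSpace ℝ (Fin m)) :
          EuclideanSpace ℝ (Fin m) →L[ℝ] EuclideanSpace ℝ (Fin m))) u ∧
      ∀ γ : c.stabilizer hu, ∀ x ∈ c.U, h (c.act γ x) = c.isotropyRep hu γ (h x) := by
  have := Fintype.ofFinite (c.stabilizer hu)
  set L := c.isotropyRep hu with hL
  set N : ℝ := (Fintype.card (c.stabilizer hu) : ℝ) with hN
  have hN0 : N ≠ 0 := Nat.cast_ne_zero.2 Fintype.card_ne_zero
  refine ⟨fun x => N⁻¹ • ∑ γ : c.stabilizer hu, L γ⁻¹ (c.act γ x - u), ?_, ?_, ?_, ?_⟩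
  · refine ContDiffOn.const_smul _ (ContDiffOn.sum fun γ _ => ?_)
    exact (L γ⁻¹).contDiff.comp_contDiffOn ((c.act_smooth γ).sub contDiffOn_const)
  · have : ∀ γ : c.stabilizer hu, L γ⁻¹ (c.act γ u - u) = 0 := fun γ => by
      have hγ : c.act γ u = u := γ.2
      rw [hγ, sub_self, map_zero]
    simp [this]
  · have h1 : ∀ γ : c.stabilizer hu, HasFDerivAt (fun x => L γ⁻¹ (c.act γ x - u))
        (ContinuousLinearMap.id ℝ (EuclideanSpace ℝ (Fin m))) u := by
      intro γ
      have h2 := (L γ⁻¹).hasFDerivAt.comp u ((c.act_hasFDerivAt γ hu).sub_const u)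
      refine h2.congr_fderiv ?_
      have h3 : L γ⁻¹ * L γ = 1 := by rw [← map_mul, inv_mul_cancel, map_one]
      exact h3
    refine ((HasFDerivAt.fun_sum fun γ _ => h1 γ).const_smul N⁻¹).congr_fderiv ?_
    ext1 v
    simp only [Finset.sum_const, Finset.card_univ, smul_apply,
      ContinuousLinearMap.id_apply]
    rw [← Nat.cast_smul_eq_nsmul ℝ, smul_smul, inv_mul_cancel₀ hN0, one_smul]
    rfl
  · intro δ x hx
    have hsum : L δ (N⁻¹ • ∑ γ : c.stabilizer hu, L γ⁻¹ (c.act γ x - u)) =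
        N⁻¹ • ∑ γ : c.stabilizer hu, L δ (L γ⁻¹ (c.act γ x - u)) := by
      rw [ContinuousLinearMap.map_smul, map_sum (L δ)]
    refine Eq.trans (congrArg (fun y => N⁻¹ • y) ?_) hsum.symm
    refine Fintype.sum_equiv (Equiv.mulRight δ) _ _ fun γ => ?_
    have h1 : L δ * L (γ * δ)⁻¹ = L γ⁻¹ := by
      rw [← map_mul, mul_inv_rev, mul_inv_cancel_left]
    rw [← h1, mul_apply_eq_comp, Equiv.coe_mulRight, Subgroup.coe_mul,
      c.act_mul _ _ x hx]

/-- An element of the local group with trivial `1`-jet at a point is trivial near this point, since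
the linearization conjugates it to its derivative. -/
theorem act_eventuallyEq_id {u : EuclideanSpace ℝ (Fin m)} (hu : u ∈ c.U) {γ : c.Γ}
    (hγ : c.act γ u = u)
    (hd : fderiv ℝ (c.act γ) u = ContinuousLinearMap.id ℝ (EuclideanSpace ℝ (Fin m))) :
    ∀ᶠ x in 𝓝 u, c.act γ x = x := by
  obtain ⟨h, hs, -, hD, heq⟩ := c.exists_bochner_linearization hu
  obtain ⟨e, he, heu, heU, -⟩ := exists_openPartialHomeomorph_of_contDiffOn c.isOpen_U hu hs hD
  have hγc : Filter.Tendsto (c.act γ) (𝓝 u) (𝓝 u) := by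
    have := (c.act_contDiffAt γ hu).continuousAt.tendsto
    rwa [hγ] at this
  have hmem := e.open_source.mem_nhds heu
  filter_upwards [hmem, hγc hmem] with x hx hx'
  apply e.injOn hx' hx
  have h1 := heq ⟨γ, hγ⟩ x (heU hx)
  rw [isotropyRep_apply] at h1
  rw [he]
  refine h1.trans ?_
  rw [hd]
  rfl

/-- An element of the local group which acts trivially near a point is trivial: the set of points
near which it acts trivially is open and relatively closed, so it contains a connected component. -/
theorem eq_one_of_eventually {y : EuclideanSpace ℝ (Fin m)} (hy : y ∈ c.U) {γ : c.Γ}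
    (hγ : ∀ᶠ x in 𝓝 y, c.act γ x = x) : γ = 1 := by
  refine c.act_faithful_component γ y hy fun z hz => ?_
  set Z := {z | ∀ᶠ x in 𝓝 z, c.act γ x = x} with hZ
  have hZo : IsOpen Z := isOpen_setOfPred_eventually_nhds
  have hsub : connectedComponentIn c.U y ⊆ Z := by
    refine isPreconnected_connectedComponentIn.subset_of_closure_inter_subset hZo
      ⟨y, mem_connectedComponentIn hy, hγ⟩ ?_
    rintro w ⟨hw, hwC⟩
    have hwU : w ∈ c.U := connectedComponentIn_subset _ _ hwC
    have hcd := c.act_contDiffAt γ hwU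
    have hfr : ∃ᶠ z in 𝓝 w, z ∈ Z := mem_closure_iff_frequently.1 hw
    -- The `1`-jets of `γ` and the identity agree at `w`, by continuity.
    refine c.act_eventuallyEq_id hwU ?_ ?_
    · by_contra hne
      have h1 : ∀ᶠ z in 𝓝 w, c.act γ z ≠ z :=
        eventually_ne_of_continuousAt hcd.continuousAt continuousAt_id hne
      obtain ⟨z, hzZ, hz1⟩ := (hfr.and_eventually h1).exists
      exact hz1 hzZ.self_of_nhds
    · by_contra hne
      have h1 : ∀ᶠ z in 𝓝 w, fderiv ℝ (c.act γ) z ≠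
          ContinuousLinearMap.id ℝ (EuclideanSpace ℝ (Fin m)) :=
        (hcd.continuousAt_fderiv (by simp)).eventually_ne hne
      obtain ⟨z, hzZ, hz1⟩ := (hfr.and_eventually h1).exists
      have h2 : c.act γ =ᶠ[𝓝 z] id := hzZ
      exact hz1 (h2.fderiv_eq.trans fderiv_id)
  exact (hsub hz).self_of_nhds

theorem eq_one_of_fderiv {u : EuclideanSpace ℝ (Fin m)} (hu : u ∈ c.U) {γ : c.Γ}
    (hγ : c.act γ u = u)
    (hd : fderiv ℝ (c.act γ) u = ContinuousLinearMap.id ℝ (EuclideanSpace ℝ (Fin m))) : γ = 1 :=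
  c.eq_one_of_eventually hu (c.act_eventuallyEq_id hu hγ hd)

theorem isotropyRep_injective {u : EuclideanSpace ℝ (Fin m)} (hu : u ∈ c.U) :
    Function.Injective (c.isotropyRep hu) := by
  rw [injective_iff_map_eq_one]
  intro γ hγ
  exact Subtype.ext (c.eq_one_of_fderiv hu γ.2 hγ)

/-- Two elements of the local group with the same `1`-jet at a point are equal. -/
theorem eq_of_jet_eq {u : EuclideanSpace ℝ (Fin m)} (hu : u ∈ c.U) {γ δ : c.Γ}
    (h0 : c.act γ u = c.act δ u) (h1 : fderiv ℝ (c.act γ) u = fderiv ℝ (c.act δ) u) : γ = δ := by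
  have hδ : c.act δ u ∈ c.U := c.act_mem δ u hu
  have key : ∀ ε : c.Γ, fderiv ℝ (c.act (δ⁻¹ * ε)) u =
      (fderiv ℝ (c.act δ⁻¹) (c.act ε u)).comp (fderiv ℝ (c.act ε) u) := by
    intro ε
    have h : c.act (δ⁻¹ * ε) =ᶠ[𝓝 u] c.act δ⁻¹ ∘ c.act ε := by
      filter_upwards [c.isOpen_U.mem_nhds hu] with x hx using c.act_mul _ _ x hx
    rw [h.fderiv_eq]
    exact ((c.act_hasFDerivAt δ⁻¹ (c.act_mem ε u hu)).comp u (c.act_hasFDerivAt ε hu)).fderiv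
  have h2 : δ⁻¹ * γ = 1 := by
    refine c.eq_one_of_fderiv hu ?_ ?_
    · rw [c.act_mul _ _ u hu, h0, c.act_inv_act δ hu]
    · rw [key, h0, h1, ← key, inv_mul_cancel]
      have h : c.act 1 =ᶠ[𝓝 u] id := by
        filter_upwards [c.isOpen_U.mem_nhds hu] with x hx using c.act_one x hx
      rw [h.fderiv_eq, fderiv_id]
  exact (inv_mul_eq_one.1 h2).symm

end OrbifoldChart

/-- A finite relatively closed cover of an open set: every point is in the closure of the interior
of some member. -/
theorem exists_mem_closure_interior {Y ι : Type*} [TopologicalSpace Y] [Finite ι] {W : Set Y}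
    (hW : IsOpen W) (F : ι → Set Y) (hF : ∀ i, IsOpen (W \ F i)) (hcov : W ⊆ ⋃ i, F i) {x : Y}
    (hx : x ∈ W) : ∃ i, x ∈ closure (interior (F i)) := by
  have := Fintype.ofFinite ι
  by_contra! hno
  set N := W ∩ ⋂ i, (closure (interior (F i)))ᶜ with hN
  have hNo : IsOpen N := hW.inter (isOpen_iInter_of_finite fun i => isClosed_closure.isOpen_compl)
  have hNx : x ∈ N := ⟨hx, Set.mem_iInter.2 hno⟩
  classical
  have step : ∀ s : Finset ι, ∃ M ⊆ N, IsOpen M ∧ M.Nonempty ∧ ∀ i ∈ s, Disjoint M (F i) := by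
    intro s
    induction s using Finset.induction_on with
    | empty => exact ⟨N, subset_rfl, hNo, ⟨x, hNx⟩, by simp⟩
    | insert i s _ ih =>
      obtain ⟨M, hMN, hMo, ⟨y, hy⟩, hMs⟩ := ih
      refine ⟨M ∩ (W \ F i), fun z hz => hMN hz.1, hMo.inter (hF i), ?_, ?_⟩
      · by_contra hempty
        rw [Set.not_nonempty_iff_eq_empty] at hempty
        have hsub : M ⊆ F i := by
          intro z hz
          by_contra hzF
          have : z ∈ M ∩ (W \ F i) := ⟨hz, (hMN hz).1, hzF⟩
          rwa [hempty] at this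
        exact Set.mem_iInter.1 (hMN hy).2 i
          (subset_closure (interior_maximal hsub hMo hy))
      · intro j hj
        rcases Finset.mem_insert.1 hj with rfl | hj
        · exact Set.disjoint_left.2 fun z hz => hz.2.2
        · exact (hMs j hj).mono_left Set.inter_subset_left
  obtain ⟨M, hMN, -, ⟨y, hy⟩, hM⟩ := step Finset.univ
  obtain ⟨i, hi⟩ := Set.mem_iUnion.1 (hcov (hMN hy).1)
  exact Set.disjoint_left.1 (hM i (Finset.mem_univ i)) hy hi

namespace OrbifoldChart

variable {X : Type*} [TopologicalSpace X] {m : ℕ} (c : OrbifoldChart X m)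

/-- Two maps into a chart over the same map to `X` differ, on a dense open set, locally by an
element of the local group. -/
theorem mem_closure_interior_eq_act {W : Set (EuclideanSpace ℝ (Fin m))} (hW : IsOpen W)
    {f g : EuclideanSpace ℝ (Fin m) → EuclideanSpace ℝ (Fin m)} (hf : ContinuousOn f W)
    (hg : ContinuousOn g W) (hfU : Set.MapsTo f W c.U) (hgU : Set.MapsTo g W c.U)
    (hφ : ∀ x ∈ W, c.φ (f x) = c.φ (g x)) {x : EuclideanSpace ℝ (Fin m)} (hx : x ∈ W) :
    ∃ γ, x ∈ closure (interior {y ∈ W | f y = c.act γ (g y)}) := by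
  refine exists_mem_closure_interior hW (fun γ => {y ∈ W | f y = c.act γ (g y)}) (fun γ => ?_) ?_ hx
  · have hpair : ContinuousOn (fun y => (f y, c.act γ (g y))) W :=
      hf.prodMk (((c.act_smooth γ).continuousOn).comp hg hgU)
    have h := hpair.isOpen_inter_preimage hW (t := (Set.diagonal (EuclideanSpace ℝ (Fin m)))ᶜ)
      isClosed_diagonal.isOpen_compl
    convert h using 1
    ext y
    simp only [Set.mem_sdiff, Set.mem_ofPred_eq, Set.mem_inter_iff, Set.mem_preimage,
      Set.mem_compl_iff, Set.mem_diagonal_iff]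
    tauto
  · intro y hy
    obtain ⟨γ, hγ⟩ := (c.φ_eq_iff _ (hgU hy) _ (hfU hy)).1 (hφ y hy).symm
    exact Set.mem_iUnion.2 ⟨γ, hy, hγ.symm⟩

/-- Rigidity: two maps from a connected open set into a chart over the same map to `X`, one of which
is a submersion, differ by a single element of the local group. The sets on which they differ by
given elements are, after replacing them by the closures of their interiors, disjoint, since on the
intersection of two of them the corresponding elements have the same `1`-jets. -/
theorem exists_eq_act {W : Set (EuclideanSpace ℝ (Fin m))} (hW : IsOpen W)
    (hWc : IsPreconnected W)
    {f g : EuclideanSpace ℝ (Fin m) → EuclideanSpace ℝ (Fin m)} (hf : ContDiffOn ℝ ∞ f W)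
    (hg : ContDiffOn ℝ ∞ g W) (hfU : Set.MapsTo f W c.U) (hgU : Set.MapsTo g W c.U)
    (hφ : ∀ x ∈ W, c.φ (f x) = c.φ (g x))
    (hsurj : ∀ x ∈ W, Function.Surjective (fderiv ℝ g x)) :
    ∃ γ, ∀ x ∈ W, f x = c.act γ (g x) := by
  rcases W.eq_empty_or_nonempty with rfl | ⟨x₀, hx₀⟩
  · exact ⟨1, fun x hx => hx.elim⟩
  set A : c.Γ → Set (EuclideanSpace ℝ (Fin m)) := fun γ =>
    closure (interior {y ∈ W | f y = c.act γ (g y)}) with hA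
  have hcov : ∀ x ∈ W, ∃ γ, x ∈ A γ := fun x hx =>
    c.mem_closure_interior_eq_act hW hf.continuousOn hg.continuousOn hfU hgU hφ hx
  have hjet : ∀ γ, ∀ x ∈ W, x ∈ A γ → f x = c.act γ (g x) ∧
      fderiv ℝ f x = (fderiv ℝ (c.act γ) (g x)).comp (fderiv ℝ g x) := by
    intro γ x hx hxA
    have hfx : ContDiffAt ℝ ∞ f x := hf.contDiffAt (hW.mem_nhds hx)
    have hgx : ContDiffAt ℝ ∞ g x := hg.contDiffAt (hW.mem_nhds hx)
    have hcx : ContDiffAt ℝ ∞ (c.act γ ∘ g) x := (c.act_contDiffAt γ (hgU hx)).comp x hgx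
    have hfr := mem_closure_iff_frequently.1 hxA
    have hloc : ∀ y ∈ interior {y ∈ W | f y = c.act γ (g y)}, f =ᶠ[𝓝 y] c.act γ ∘ g :=
      fun y hy => by
        filter_upwards [isOpen_interior.mem_nhds hy] with z hz using (interior_subset hz).2
    have hfd : fderiv ℝ (c.act γ ∘ g) x = (fderiv ℝ (c.act γ) (g x)).comp (fderiv ℝ g x) :=
      ((c.act_hasFDerivAt γ (hgU hx)).comp x
        (hgx.differentiableAt (by simp)).hasFDerivAt).fderiv
    rw [← hfd]
    constructor
    · by_contra hne
      have h1 : ∀ᶠ z in 𝓝 x, f z ≠ (c.act γ ∘ g) z :=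
        eventually_ne_of_continuousAt hfx.continuousAt hcx.continuousAt hne
      obtain ⟨z, hz, hz1⟩ := (hfr.and_eventually h1).exists
      exact hz1 (hloc z hz).self_of_nhds
    · by_contra hne
      have h1 : ∀ᶠ z in 𝓝 x, fderiv ℝ f z ≠ fderiv ℝ (c.act γ ∘ g) z :=
        eventually_ne_of_continuousAt (hfx.continuousAt_fderiv (by simp))
          (hcx.continuousAt_fderiv (by simp)) hne
      obtain ⟨z, hz, hz1⟩ := (hfr.and_eventually h1).exists
      exact hz1 (hloc z hz).fderiv_eq
  have hdisj : ∀ γ δ, ∀ x ∈ W, x ∈ A γ → x ∈ A δ → γ = δ := by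
    intro γ δ x hx hxγ hxδ
    obtain ⟨h1, h2⟩ := hjet γ x hx hxγ
    obtain ⟨h3, h4⟩ := hjet δ x hx hxδ
    refine c.eq_of_jet_eq (hgU hx) (h1.symm.trans h3) ?_
    ext1 v
    obtain ⟨v, rfl⟩ := hsurj x hx v
    exact congrArg (fun T => T v) (h2.symm.trans h4)
  obtain ⟨γ, hγ⟩ := hcov x₀ hx₀
  refine ⟨γ, fun x hx => ?_⟩
  obtain ⟨δ, hδ⟩ := hcov x hx
  by_cases hne : δ = γ
  · rw [hne] at hδ
    exact (hjet γ x hx hδ).1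
  exfalso
  have hclosed : IsClosed (⋃ δ : {δ // δ ≠ γ}, A δ) :=
    isClosed_iUnion_of_finite fun δ => isClosed_closure
  obtain ⟨y, hyW, hyγ, hy⟩ := isPreconnected_closed_iff.1 hWc (A γ) (⋃ δ : {δ // δ ≠ γ}, A δ)
    isClosed_closure hclosed
    (fun y hy => by
      obtain ⟨ε, hε⟩ := hcov y hy
      by_cases h : ε = γ
      · exact Or.inl (h ▸ hε)
      · exact Or.inr (Set.mem_iUnion.2 ⟨⟨ε, h⟩, hε⟩))
    ⟨x₀, hx₀, hγ⟩ ⟨x, hx, Set.mem_iUnion.2 ⟨⟨δ, hne⟩, hδ⟩⟩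
  obtain ⟨⟨ε, hε⟩, hyε⟩ := Set.mem_iUnion.1 hy
  exact hε (hdisj ε γ y hyW hyε hyγ)

end OrbifoldChart

/-! ### Embeddings of charts and compatibility with an atlas -/

namespace OrbifoldChart

variable {X : Type*} [TopologicalSpace X] {m : ℕ} {a c d : OrbifoldChart X m}

/-- Elements of the local group are determined by their germ at a point. -/
theorem eq_of_act_eventuallyEq (c : OrbifoldChart X m) {u : EuclideanSpace ℝ (Fin m)} (hu : u ∈ c.U)
    {γ δ : c.Γ} (h : c.act γ =ᶠ[𝓝 u] c.act δ) : γ = δ :=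
  c.eq_of_jet_eq hu h.self_of_nhds h.fderiv_eq

namespace Embedding

theorem injOn (k : Embedding c a) : Set.InjOn k.toFun c.U := by
  obtain ⟨g, -, hg⟩ := k.exists_smooth_inverse
  intro x hx y hy h
  rw [← hg x hx, h, hg y hy]

/-- An embedding of charts as a partial homeomorphism with source the domain of the chart. -/
noncomputable def toOpenPartialHomeomorph (k : Embedding c a) :
    OpenPartialHomeomorph (EuclideanSpace ℝ (Fin m)) (EuclideanSpace ℝ (Fin m)) where
  toFun := k.toFun
  invFun := k.exists_smooth_inverse.choose
  source := c.U
  target := k.toFun '' c.U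
  map_source' _ hx := Set.mem_image_of_mem _ hx
  map_target' := by
    rintro _ ⟨x, hx, rfl⟩
    rwa [k.exists_smooth_inverse.choose_spec.2 x hx]
  left_inv' := k.exists_smooth_inverse.choose_spec.2
  right_inv' := by
    rintro _ ⟨x, hx, rfl⟩
    rw [k.exists_smooth_inverse.choose_spec.2 x hx]
  open_source := c.isOpen_U
  open_target := k.isOpen_image
  continuousOn_toFun := k.smooth.continuousOn
  continuousOn_invFun := k.exists_smooth_inverse.choose_spec.1.continuousOn

/-- The inverse of an embedding of charts, defined on its image. -/
noncomputable def inv (k : Embedding c a) :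
    EuclideanSpace ℝ (Fin m) → EuclideanSpace ℝ (Fin m) := k.toOpenPartialHomeomorph.symm

theorem inv_contDiffOn (k : Embedding c a) : ContDiffOn ℝ ∞ k.inv (k.toFun '' c.U) :=
  k.exists_smooth_inverse.choose_spec.1

theorem inv_apply (k : Embedding c a) {x : EuclideanSpace ℝ (Fin m)} (hx : x ∈ c.U) :
    k.inv (k.toFun x) = x := k.exists_smooth_inverse.choose_spec.2 x hx

theorem inv_mem (k : Embedding c a) {y : EuclideanSpace ℝ (Fin m)} (hy : y ∈ k.toFun '' c.U) :
    k.inv y ∈ c.U := k.toOpenPartialHomeomorph.map_target hy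

theorem apply_inv (k : Embedding c a) {y : EuclideanSpace ℝ (Fin m)} (hy : y ∈ k.toFun '' c.U) :
    k.toFun (k.inv y) = y := k.toOpenPartialHomeomorph.right_inv hy

theorem contDiffAt (k : Embedding c a) {x : EuclideanSpace ℝ (Fin m)} (hx : x ∈ c.U) :
    ContDiffAt ℝ ∞ k.toFun x := k.smooth.contDiffAt (c.isOpen_U.mem_nhds hx)

theorem differentiableAt (k : Embedding c a) {x : EuclideanSpace ℝ (Fin m)} (hx : x ∈ c.U) :
    DifferentiableAt ℝ k.toFun x := (k.contDiffAt hx).differentiableAt (by simp)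

theorem V_subset (k : Embedding c a) : c.V ⊆ a.V := by
  rintro _ ⟨x, hx, rfl⟩
  exact ⟨k.toFun x, k.mapsTo hx, k.comm x hx⟩

/-- The composition of two embeddings of charts. -/
noncomputable def comp (k : Embedding c a) (i : Embedding d c) : Embedding d a where
  ρ := k.ρ.comp i.ρ
  ρ_injective := k.ρ_injective.comp i.ρ_injective
  toFun := k.toFun ∘ i.toFun
  mapsTo := k.mapsTo.comp i.mapsTo
  smooth := k.smooth.comp i.smooth i.mapsTo
  isOpen_image := by
    rw [Set.image_comp]
    exact k.toOpenPartialHomeomorph.isOpen_image_of_subset_source i.isOpen_image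
      i.mapsTo.image_subset
  exists_smooth_inverse := by
    refine ⟨i.inv ∘ k.inv, i.inv_contDiffOn.comp (k.inv_contDiffOn.mono ?_) ?_, fun x hx => ?_⟩
    · rintro _ ⟨x, hx, rfl⟩
      exact ⟨_, i.mapsTo hx, rfl⟩
    · rintro _ ⟨x, hx, rfl⟩
      rw [Function.comp_apply, k.inv_apply (i.mapsTo hx)]
      exact ⟨x, hx, rfl⟩
    · rw [Function.comp_apply, Function.comp_apply, k.inv_apply (i.mapsTo hx), i.inv_apply hx]
  equivariant γ x hx := by
    rw [Function.comp_apply, i.equivariant γ x hx, k.equivariant _ _ (i.mapsTo hx)]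
    rfl
  comm x hx := by rw [Function.comp_apply, k.comm _ (i.mapsTo hx), i.comm x hx]

/-- An element of the local group as an embedding of the chart into itself; the homomorphism of
local groups is a conjugation. -/
def ofAct (a : OrbifoldChart X m) (γ : a.Γ) : Embedding a a where
  ρ := (MulAut.conj γ).toMonoidHom
  ρ_injective := (MulAut.conj γ).injective
  toFun := a.act γ
  mapsTo := a.act_mem γ
  smooth := a.act_smooth γ
  isOpen_image := by
    convert a.isOpen_U
    ext x
    refine ⟨?_, fun hx => ⟨a.act γ⁻¹ x, a.act_mem _ x hx, a.act_act_inv γ hx⟩⟩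
    rintro ⟨y, hy, rfl⟩
    exact a.act_mem γ y hy
  exists_smooth_inverse := by
    refine ⟨a.act γ⁻¹, (a.act_smooth γ⁻¹).mono ?_, fun x hx => a.act_inv_act γ hx⟩
    rintro _ ⟨y, hy, rfl⟩
    exact a.act_mem γ y hy
  equivariant δ x hx := by
    change a.act γ (a.act δ x) = a.act (γ * δ * γ⁻¹) (a.act γ x)
    rw [← a.act_mul _ _ x hx, ← a.act_mul _ _ x hx, inv_mul_cancel_right]
  comm x hx := a.φ_act γ hx

/-- If two embeddings hit points of a chart with the same image in `X`, then they hit the same point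
after composing one of them with an element of the local group. -/
theorem exists_act_comp_eq (k : Embedding c a) (i : Embedding d a)
    {y z : EuclideanSpace ℝ (Fin m)} (hy : y ∈ c.U) (hz : z ∈ d.U) (h : c.φ y = d.φ z) :
    ∃ k' : Embedding c a, k'.toFun y = i.toFun z := by
  obtain ⟨γ, hγ⟩ := (a.φ_eq_iff _ (k.mapsTo hy) _ (i.mapsTo hz)).1
    (by rw [k.comm y hy, i.comm z hz, h])
  exact ⟨(ofAct a γ).comp k, hγ⟩

/-- The image of the homomorphism of local groups contains the stabilizers of all points in the
image of an embedding. -/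
theorem exists_ρ_eq (k : Embedding c a) {y : EuclideanSpace ℝ (Fin m)} (hy : y ∈ c.U) {γ : a.Γ}
    (hγ : a.act γ (k.toFun y) = k.toFun y) : ∃ δ, k.ρ δ = γ := by
  have hcont : ContinuousOn (a.act γ ∘ k.toFun) c.U :=
    (a.act_smooth γ).continuousOn.comp k.smooth.continuousOn k.mapsTo
  set S := c.U ∩ (a.act γ ∘ k.toFun) ⁻¹' (k.toFun '' c.U) with hS
  have hSo : IsOpen S := hcont.isOpen_inter_preimage c.isOpen_U k.isOpen_image
  have hyS : y ∈ S := ⟨hy, y, hy, hγ.symm⟩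
  obtain ⟨r, hr, hB⟩ := Metric.isOpen_iff.1 hSo y hyS
  set B := Metric.ball y r
  have hBU : B ⊆ c.U := fun x hx => (hB hx).1
  obtain ⟨δ, hδ⟩ := c.exists_eq_act (W := B) (f := k.inv ∘ a.act γ ∘ k.toFun) (g := id)
    Metric.isOpen_ball (convex_ball y r).isPreconnected
    (k.inv_contDiffOn.comp (((a.act_smooth γ).comp k.smooth k.mapsTo).mono hBU)
      fun x hx => (hB hx).2)
    contDiff_id.contDiffOn (fun x hx => k.inv_mem (hB hx).2) hBU
    (fun x hx => by
      have hx' := (hB hx).2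
      have h1 := k.comm _ (k.inv_mem hx')
      rw [k.apply_inv hx'] at h1
      refine h1.symm.trans ?_
      exact (a.φ_act γ (k.mapsTo (hBU hx))).trans (k.comm x (hBU hx)))
    (fun x _ => by rw [fderiv_id]; exact Function.surjective_id)
  refine ⟨δ, (a.eq_of_act_eventuallyEq (k.mapsTo hy) ?_).symm⟩
  have hnhds : k.toFun '' B ∈ 𝓝 (k.toFun y) :=
    (k.toOpenPartialHomeomorph.isOpen_image_of_subset_source Metric.isOpen_ball hBU).mem_nhds
      ⟨y, Metric.mem_ball_self hr, rfl⟩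
  filter_upwards [hnhds]
  rintro _ ⟨x, hx, rfl⟩
  rw [← k.equivariant δ x (hBU hx)]
  have h1 := congrArg k.toFun (hδ x hx)
  exact (k.apply_inv (hB hx).2).symm.trans h1

/-- An embedding into a chart factors through a second embedding, if its image is contained in the
image of the second, both on the level of domains and on the level of groups. -/
theorem nonempty_factor (i : Embedding d a) (k : Embedding c a)
    (himg : i.toFun '' d.U ⊆ k.toFun '' c.U) (hρ : ∀ γ, ∃ δ, k.ρ δ = i.ρ γ) :
    Nonempty (Embedding d c) := by
  choose r hr using hρ
  have hmem : ∀ x ∈ d.U, i.toFun x ∈ k.toFun '' c.U := fun x hx => himg ⟨x, hx, rfl⟩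
  refine ⟨{
    ρ := {
      toFun := r
      map_one' := k.ρ_injective (by rw [hr, map_one, map_one])
      map_mul' := fun γ δ => k.ρ_injective (by rw [hr, map_mul, map_mul, hr, hr]) }
    ρ_injective := fun γ δ h => i.ρ_injective (by rw [← hr, ← hr]; exact congrArg k.ρ h)
    toFun := k.inv ∘ i.toFun
    mapsTo := fun x hx => k.inv_mem (hmem x hx)
    smooth := k.inv_contDiffOn.comp i.smooth hmem
    isOpen_image := by
      rw [Set.image_comp]
      exact k.toOpenPartialHomeomorph.symm.isOpen_image_of_subset_source i.isOpen_image himg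
    exists_smooth_inverse := by
      refine ⟨i.inv ∘ k.toFun, i.inv_contDiffOn.comp (k.smooth.mono ?_) ?_, fun x hx => ?_⟩
      · rintro _ ⟨x, hx, rfl⟩
        exact k.inv_mem (hmem x hx)
      · rintro _ ⟨x, hx, rfl⟩
        rw [Function.comp_apply, k.apply_inv (hmem x hx)]
        exact ⟨x, hx, rfl⟩
      · rw [Function.comp_apply, Function.comp_apply, k.apply_inv (hmem x hx), i.inv_apply hx]
    equivariant := fun γ x hx => by
      have hx1 := d.act_mem γ x hx
      apply k.injOn (k.inv_mem (hmem _ hx1)) (c.act_mem _ _ (k.inv_mem (hmem x hx)))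
      rw [k.equivariant _ _ (k.inv_mem (hmem x hx)), k.apply_inv (hmem x hx)]
      refine (k.apply_inv (hmem _ hx1)).trans ?_
      change _ = a.act (k.ρ (r γ)) _
      rw [hr]
      exact i.equivariant γ x hx
    comm := fun x hx => by
      rw [Function.comp_apply, ← k.comm _ (k.inv_mem (hmem x hx)), k.apply_inv (hmem x hx)]
      exact i.comm x hx }⟩

end Embedding

/-- A parametrization of a neighbourhood of `u` in the domain of a chart, which intertwines a linear
representation of the stabilizer of `u` with its action near `u`, gives arbitrarily small charts
around the image of `u` with this parametrization, embedded into the given chart. -/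
theorem exists_chart_of_parametrization (a : OrbifoldChart X m) {u : EuclideanSpace ℝ (Fin m)}
    (hu : u ∈ a.U)
    (e : OpenPartialHomeomorph (EuclideanSpace ℝ (Fin m)) (EuclideanSpace ℝ (Fin m)))
    (h0 : 0 ∈ e.source) (he0 : e 0 = u) (htgt : e.target ⊆ a.U)
    (hsm : ContDiffOn ℝ ∞ e e.source) (hsm' : ContDiffOn ℝ ∞ e.symm e.target)
    (L : a.stabilizer hu →* (EuclideanSpace ℝ (Fin m) →L[ℝ] EuclideanSpace ℝ (Fin m)))
    (hL : ∀ γ, ∀ᶠ x in 𝓝 0, e (L γ x) = a.act γ (e x))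
    {N : Set (EuclideanSpace ℝ (Fin m))} (hN : N ∈ 𝓝 0) :
    ∃ (c : OrbifoldChart X m) (k : c.Embedding a) (r : c.Γ →* a.stabilizer hu),
      Function.Injective r ∧ 0 ∈ c.U ∧ c.U ⊆ N ∧ c.U ⊆ e.source ∧ k.toFun = e ∧
      (∀ γ x, c.act γ x = L (r γ) x) ∧ ∀ γ, k.ρ γ = r γ := by
  have he0c : ContinuousAt e 0 := e.continuousAt h0
  have h1 : ∀ᶠ x in 𝓝 (0 : EuclideanSpace ℝ (Fin m)), x ∈ N ∧ x ∈ e.source ∧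
      ∀ γ, e (L γ x) = a.act γ (e x) := by
    filter_upwards [hN, e.open_source.mem_nhds h0, Filter.eventually_all.2 hL] with x h1 h2 h3
      using ⟨h1, h2, h3⟩
  -- Elements of the local group outside the stabilizer move a small neighbourhood off itself.
  have h2 : ∀ᶠ p in 𝓝 ((0, 0) : EuclideanSpace ℝ (Fin m) × EuclideanSpace ℝ (Fin m)),
      ∀ γ : a.Γ, a.act γ u ≠ u → a.act γ (e p.1) ≠ e p.2 := by
    refine Filter.eventually_all.2 fun γ => ?_
    by_cases hγ : a.act γ u = u
    · exact Filter.Eventually.of_forall fun p h => (h hγ).elim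
    have hc1 : ContinuousAt (fun p : EuclideanSpace ℝ (Fin m) × EuclideanSpace ℝ (Fin m) =>
        a.act γ (e p.1)) (0, 0) := by
      have h3 : ContinuousAt (a.act γ) (e 0) := by
        rw [he0]
        exact (a.act_contDiffAt γ hu).continuousAt
      exact ContinuousAt.comp (f := Prod.fst) (g := fun x => a.act γ (e x))
        (x := ((0, 0) : EuclideanSpace ℝ (Fin m) × EuclideanSpace ℝ (Fin m)))
        (h3.comp he0c) continuousAt_fst
    have hc2 : ContinuousAt (fun p : EuclideanSpace ℝ (Fin m) × EuclideanSpace ℝ (Fin m) =>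
        e p.2) (0, 0) :=
      he0c.comp (x := ((0, 0) : EuclideanSpace ℝ (Fin m) × EuclideanSpace ℝ (Fin m)))
        continuousAt_snd
    filter_upwards [eventually_ne_of_continuousAt hc1 hc2 (by simpa [he0] using hγ)] with p hp _
      using hp
  rw [nhds_prod_eq, Filter.eventually_prod_self_iff'] at h2
  obtain ⟨t, ht, h2⟩ := h2
  obtain ⟨ε, hε, hball⟩ := Metric.eventually_nhds_iff_ball.1 (h1.and ht)
  -- The set of points with orbit in a small ball is an invariant convex neighbourhood.
  set W : Set (EuclideanSpace ℝ (Fin m)) := ⋂ γ, L γ ⁻¹' Metric.ball 0 ε with hW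
  have hWo : IsOpen W :=
    isOpen_iInter_of_finite fun γ => Metric.isOpen_ball.preimage (L γ).continuous
  have hWc : Convex ℝ W :=
    convex_iInter fun γ => (convex_ball 0 ε).is_linear_preimage (L γ).isLinear
  have h0W : (0 : EuclideanSpace ℝ (Fin m)) ∈ W :=
    Set.mem_iInter.2 fun γ => by simp [hε]
  have hL1 : ∀ x, L 1 x = x := fun x => by rw [map_one]; rfl
  have hLmul : ∀ γ δ x, L (γ * δ) x = L γ (L δ x) := fun γ δ x => by rw [map_mul]; rfl
  have hWL : ∀ γ, ∀ x ∈ W, L γ x ∈ W := fun γ x hx => by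
    refine Set.mem_iInter.2 fun δ => ?_
    rw [Set.mem_preimage, ← hLmul]
    exact Set.mem_iInter.1 hx (δ * γ)
  have hWb : ∀ x ∈ W, x ∈ Metric.ball (0 : EuclideanSpace ℝ (Fin m)) ε := fun x hx => by
    have := Set.mem_iInter.1 hx 1
    rwa [Set.mem_preimage, hL1] at this
  have hWN : W ⊆ N := fun x hx => (hball x (hWb x hx)).1.1
  have hWs : W ⊆ e.source := fun x hx => (hball x (hWb x hx)).1.2.1
  have hWe : ∀ γ, ∀ x ∈ W, e (L γ x) = a.act γ (e x) := fun γ x hx =>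
    (hball x (hWb x hx)).1.2.2 γ
  have hWU : ∀ x ∈ W, e x ∈ a.U := fun x hx => htgt (e.map_source (hWs hx))
  have hWpair : ∀ x ∈ W, ∀ y ∈ W, ∀ γ : a.Γ, a.act γ (e x) = e y → a.act γ u = u :=
    fun x hx y hy γ h => by
      by_contra hne
      exact h2 x (hball x (hWb x hx)).2 y (hball y (hWb y hy)).2 γ hne h
  have hfaith : ∀ γ, (∀ x ∈ W, L γ x = x) → γ = 1 := fun γ hγ => by
    refine Subtype.ext (a.eq_one_of_eventually hu ?_)
    have hnhds : e '' W ∈ 𝓝 u :=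
      (e.isOpen_image_of_subset_source hWo hWs).mem_nhds ⟨0, h0W, he0⟩
    filter_upwards [hnhds]
    rintro _ ⟨x, hx, rfl⟩
    rw [← hWe γ x hx, hγ x hx]
  let c : OrbifoldChart X m :=
    { U := W
      isOpen_U := hWo
      Γ := a.stabilizer hu
      act := fun γ => L γ
      act_mem := hWL
      act_one := fun x _ => hL1 x
      act_mul := fun γ δ x _ => hLmul γ δ x
      act_smooth := fun γ => (L γ).contDiff.contDiffOn
      act_faithful := hfaith
      act_faithful_component := fun γ x hx h => by
        rw [hWc.isPreconnected.connectedComponentIn hx] at h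
        exact hfaith γ h
      φ := a.φ ∘ e
      φ_eq_iff := fun x hx y hy => by
        rw [Function.comp_apply, Function.comp_apply, a.φ_eq_iff _ (hWU x hx) _ (hWU y hy)]
        constructor
        · rintro ⟨γ, hγ⟩
          refine ⟨⟨γ, hWpair x hx y hy γ hγ⟩, e.injOn (hWs (hWL _ x hx)) (hWs hy) ?_⟩
          rw [hWe _ x hx, hγ]
        · rintro ⟨γ, rfl⟩
          exact ⟨γ, (hWe γ x hx).symm⟩
      φ_continuousOn := a.φ_continuousOn.comp (e.continuousOn.mono hWs) hWU
      φ_open := fun S hS hSo => by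
        rw [Set.image_comp]
        refine a.φ_open _ ?_ (e.isOpen_image_of_subset_source hSo (hS.trans hWs))
        rintro _ ⟨x, hx, rfl⟩
        exact hWU x (hS hx) }
  let k : c.Embedding a :=
    { ρ := (a.stabilizer hu).subtype
      ρ_injective := Subtype.val_injective
      toFun := e
      mapsTo := hWU
      smooth := hsm.mono hWs
      isOpen_image := e.isOpen_image_of_subset_source hWo hWs
      exists_smooth_inverse := by
        refine ⟨e.symm, hsm'.mono ?_, fun x hx => e.left_inv (hWs hx)⟩
        rintro _ ⟨x, hx, rfl⟩
        exact e.map_source (hWs hx)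
      equivariant := fun γ x hx => hWe γ x hx
      comm := fun x _ => rfl }
  exact ⟨c, k, MonoidHom.id _, Function.injective_id, h0W, hWN, hWs, rfl, fun _ _ => rfl,
    fun _ => rfl⟩

/-- Around every point there is a parametrization, defined near the origin, in which the stabilizer
acts linearly through the isotropy representation. -/
theorem exists_linearizing_parametrization (a : OrbifoldChart X m) {u : EuclideanSpace ℝ (Fin m)}
    (hu : u ∈ a.U) {O : Set (EuclideanSpace ℝ (Fin m))} (hO : IsOpen O) (huO : u ∈ O) :
    ∃ e : OpenPartialHomeomorph (EuclideanSpace ℝ (Fin m)) (EuclideanSpace ℝ (Fin m)),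
      0 ∈ e.source ∧ e 0 = u ∧ e.target ⊆ a.U ∩ O ∧ ContDiffOn ℝ ∞ e e.source ∧
      ContDiffOn ℝ ∞ e.symm e.target ∧
      ∀ γ, ∀ᶠ x in 𝓝 0, e (a.isotropyRep hu γ x) = a.act γ (e x) := by
  obtain ⟨h, hs, hu0, hD, heq⟩ := a.exists_bochner_linearization hu
  obtain ⟨e, he, heu, heU, hsm⟩ := exists_openPartialHomeomorph_of_contDiffOn
    (a.isOpen_U.inter hO) ⟨hu, huO⟩ (hs.mono Set.inter_subset_left) hD
  have he0 : e u = 0 := by rw [he, hu0]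
  have hsymm : e.symm 0 = u := by rw [← he0, e.left_inv heu]
  have h0 : 0 ∈ e.target := he0 ▸ e.map_source heu
  refine ⟨e.symm, h0, hsymm, heU, hsm, ?_, fun γ => ?_⟩
  · rw [OpenPartialHomeomorph.symm_symm, he]
    exact hs.mono fun x hx => (heU hx).1
  have hγ : a.act γ u = u := γ.2
  have hc : Filter.Tendsto (fun x => a.act γ (e.symm x)) (𝓝 0) (𝓝 u) := by
    have h1 := (e.symm.continuousAt h0).tendsto
    rw [hsymm] at h1
    have h2 := (a.act_contDiffAt γ hu).continuousAt.tendsto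
    rw [hγ] at h2
    exact h2.comp h1
  filter_upwards [e.open_target.mem_nhds h0, hc (e.open_source.mem_nhds heu)] with x hx hx'
  have h3 := heq γ _ (heU (e.map_target hx)).1
  rw [← he, e.right_inv hx] at h3
  rw [← h3, e.left_inv hx']

end OrbifoldChart

namespace OrbifoldAtlas

open OrbifoldChart

variable {X : Type*} [TopologicalSpace X] {m : ℕ} (A : OrbifoldAtlas X m)

/-- A chart that embeds into a chart of the atlas is compatible with the atlas. -/
theorem isOrbifoldChart_of_embedding {c : OrbifoldChart X m} {a : A.Index}
    (k : c.Embedding (A.chart a)) : A.IsOrbifoldChart c := by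
  rintro b _ ⟨⟨y, hy, rfl⟩, hyb⟩
  obtain ⟨e, ⟨z, hz, hzy⟩, -, ⟨p⟩, ⟨q⟩⟩ := A.compatible a b (c.φ y) ⟨k.V_subset ⟨y, hy, rfl⟩, hyb⟩
  obtain ⟨p', hp'⟩ := p.exists_act_comp_eq k hz hy hzy
  have hu : k.toFun y ∈ (A.chart a).U := k.mapsTo hy
  -- A small chart around `k y`, whose local group is the stabilizer, factors through both.
  obtain ⟨f, h0, hf0, htgt, hsm, hsm', hL⟩ := (A.chart a).exists_linearizing_parametrization hu
    (k.isOpen_image.inter p'.isOpen_image) ⟨⟨y, hy, rfl⟩, ⟨z, hz, hp'⟩⟩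
  obtain ⟨d, i, r, -, h0d, -, hds, hi, -, hρ⟩ := (A.chart a).exists_chart_of_parametrization hu f h0
    hf0 (htgt.trans Set.inter_subset_left) hsm hsm' _ hL Filter.univ_mem
  have himg : i.toFun '' d.U ⊆ k.toFun '' c.U ∩ p'.toFun '' (A.chart e).U := by
    rintro _ ⟨x, hx, rfl⟩
    rw [hi]
    exact (htgt (f.map_source (hds hx))).2
  have hfix : ∀ γ, (A.chart a).act (i.ρ γ) (k.toFun y) = k.toFun y := fun γ => by
    rw [hρ]
    exact (r γ).2
  obtain ⟨dc⟩ := i.nonempty_factor k (himg.trans Set.inter_subset_left)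
    fun γ => k.exists_ρ_eq hy (hfix γ)
  obtain ⟨de⟩ := i.nonempty_factor p' (himg.trans Set.inter_subset_right)
    fun γ => p'.exists_ρ_eq hz (by rw [hp', hfix])
  refine ⟨d, ⟨0, h0d, ?_⟩, fun x hx => ⟨dc.V_subset hx, (q.comp de).V_subset hx⟩, ⟨dc⟩, ⟨q.comp de⟩⟩
  rw [← i.comm 0 h0d, hi, hf0, k.comm y hy]

end OrbifoldAtlas

/-! ### Local expressions of orbifold forms -/

theorem formPullback_comp {m k : ℕ} {f g : EuclideanSpace ℝ (Fin m) → EuclideanSpace ℝ (Fin m)}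
    (η : EuclideanSpace ℝ (Fin m) → EuclideanSpace ℝ (Fin m) [⋀^Fin k]→L[ℝ] ℝ)
    {x : EuclideanSpace ℝ (Fin m)} (hf : DifferentiableAt ℝ f (g x)) (hg : DifferentiableAt ℝ g x) :
    formPullback (f ∘ g) η x = formPullback g (formPullback f η) x := by
  simp only [formPullback]
  rw [fderiv_comp x hf hg]
  rfl

theorem formPullback_congr_map {m k : ℕ}
    {f g : EuclideanSpace ℝ (Fin m) → EuclideanSpace ℝ (Fin m)}
    (η : EuclideanSpace ℝ (Fin m) → EuclideanSpace ℝ (Fin m) [⋀^Fin k]→L[ℝ] ℝ)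
    {x : EuclideanSpace ℝ (Fin m)} (h : f =ᶠ[𝓝 x] g) : formPullback f η x = formPullback g η x := by
  simp only [formPullback]
  rw [h.fderiv_eq, h.self_of_nhds]

theorem formPullback_congr_form {m k : ℕ}
    {f : EuclideanSpace ℝ (Fin m) → EuclideanSpace ℝ (Fin m)}
    {η η' : EuclideanSpace ℝ (Fin m) → EuclideanSpace ℝ (Fin m) [⋀^Fin k]→L[ℝ] ℝ}
    {x : EuclideanSpace ℝ (Fin m)} (h : η (f x) = η' (f x)) :
    formPullback f η x = formPullback f η' x := by
  simp only [formPullback, h]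

theorem continuousAt_formPullback {m k : ℕ}
    {f : EuclideanSpace ℝ (Fin m) → EuclideanSpace ℝ (Fin m)}
    {η : EuclideanSpace ℝ (Fin m) → EuclideanSpace ℝ (Fin m) [⋀^Fin k]→L[ℝ] ℝ}
    {x : EuclideanSpace ℝ (Fin m)} (hη : ContinuousAt η (f x)) (hf : ContDiffAt ℝ ∞ f x) :
    ContinuousAt (formPullback f η) x := by
  have h1 : ContinuousAt (fun y => ContinuousAlternatingMap.compContinuousLinearMapCLM
      (ι := Fin k) (F := ℝ) (fderiv ℝ f y)) x :=
    ContinuousAlternatingMap.continuous_compContinuousLinearMapCLM.continuousAt.comp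
      (hf.continuousAt_fderiv (by simp))
  exact h1.clm_apply (hη.comp hf.continuousAt)

/-- Smoothness can be tested after an injective linear map to a finite-dimensional space. -/
theorem contDiffOn_of_injective_clm {V W Y : Type*} [NormedAddCommGroup V] [NormedSpace ℝ V]
    [NormedAddCommGroup W] [NormedSpace ℝ W] [FiniteDimensional ℝ W] [NormedAddCommGroup Y]
    [NormedSpace ℝ Y] {T : V →L[ℝ] W} (hT : Function.Injective T) {f : Y → V} {S : Set Y}
    (h : ContDiffOn ℝ ∞ (fun x => T (f x)) S) : ContDiffOn ℝ ∞ f S := by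
  have hfin : FiniteDimensional ℝ V := FiniteDimensional.of_injective T.toLinearMap hT
  obtain ⟨P, hP⟩ := LinearMap.exists_leftInverse_of_injective T.toLinearMap
    (LinearMap.ker_eq_bot.2 hT)
  refine ((LinearMap.toContinuousLinearMap P).contDiff.comp_contDiffOn h).congr fun x _ => ?_
  exact (LinearMap.congr_fun hP (f x)).symm

/-- The pullback of a smooth `2`-form by a smooth map is smooth. -/
theorem contDiffOn_formPullback_two {m : ℕ}
    {f : EuclideanSpace ℝ (Fin m) → EuclideanSpace ℝ (Fin m)}
    {η : EuclideanSpace ℝ (Fin m) → EuclideanSpace ℝ (Fin m) [⋀^Fin 2]→L[ℝ] ℝ}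
    {S T : Set (EuclideanSpace ℝ (Fin m))} (hS : IsOpen S) (hη : ContDiffOn ℝ ∞ η T)
    (hf : ContDiffOn ℝ ∞ f S) (hfT : Set.MapsTo f S T) : ContDiffOn ℝ ∞ (formPullback f η) S := by
  have hinj : Function.Injective (alternatingToBilinear (EuclideanSpace ℝ (Fin m))) := by
    intro α β h
    ext v
    have h1 : alternatingToBilinear _ α (v 0) (v 1) = alternatingToBilinear _ β (v 0) (v 1) := by
      rw [h]
    rw [alternatingToBilinear_apply, alternatingToBilinear_apply] at h1
    convert h1 using 2 <;> (ext1 i; fin_cases i <;> rfl)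
  have key : ContDiffOn ℝ ∞ (fun x => alternatingToBilinear _ (formPullback f η x)) S := by
    rw [contDiffOn_clm_apply]
    intro v
    rw [contDiffOn_clm_apply]
    intro w
    have hfd : ContDiffOn ℝ ∞ (fderiv ℝ f) S := hf.fderiv_of_isOpen hS (by simp)
    have h0 : ContDiff ℝ ∞ (alternatingToBilinear (EuclideanSpace ℝ (Fin m))) := by fun_prop
    have h1 : ContDiffOn ℝ ∞ (fun x => alternatingToBilinear _ (η (f x))) S :=
      h0.comp_contDiffOn (hη.comp hf hfT)
    have h2 := (h1.clm_apply (hfd.clm_apply (contDiffOn_const (c := v)))).clm_apply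
      (hfd.clm_apply (contDiffOn_const (c := w)))
    refine h2.congr fun x _ => ?_
    rw [alternatingToBilinear_apply, alternatingToBilinear_apply]
    change η (f x) _ = _
    congr 1
    ext1 i
    fin_cases i <;> rfl
  exact contDiffOn_of_injective_clm hinj key

namespace OrbifoldAtlas

open OrbifoldChart

variable {X : Type*} [TopologicalSpace X] {m : ℕ} {A : OrbifoldAtlas X m} {k : ℕ}

/-- The local expressions of an orbifold form agree under all changes of charts through an
arbitrary chart, which need not belong to the atlas. On a dense open set, the change of charts
is locally a change of charts through a chart of the atlas. -/
theorem DiffForm.agree_of_embeddings (Ω : A.DiffForm k) {a b : A.Index} {d : OrbifoldChart X m}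
    (i : d.Embedding (A.chart a)) (j : d.Embedding (A.chart b)) {x : EuclideanSpace ℝ (Fin m)}
    (hx : x ∈ d.U) : formPullback i.toFun (Ω.form a) x = formPullback j.toFun (Ω.form b) x := by
  obtain ⟨e, ⟨z, hz, hzx⟩, -, ⟨p⟩, ⟨q⟩⟩ := A.compatible a b (d.φ x)
    ⟨i.V_subset ⟨x, hx, rfl⟩, j.V_subset ⟨x, hx, rfl⟩⟩
  obtain ⟨p', hp'⟩ := p.exists_act_comp_eq i hz hx hzx
  set S := d.U ∩ i.toFun ⁻¹' (p'.toFun '' (A.chart e).U) with hS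
  have hSo : IsOpen S := i.smooth.continuousOn.isOpen_inter_preimage d.isOpen_U p'.isOpen_image
  have hxS : x ∈ S := ⟨hx, z, hz, hp'⟩
  set h := p'.inv ∘ i.toFun with hh
  have hhs : ContDiffOn ℝ ∞ h S :=
    p'.inv_contDiffOn.comp (i.smooth.mono Set.inter_subset_left) fun y hy => hy.2
  have hhU : Set.MapsTo h S (A.chart e).U := fun y hy => p'.inv_mem hy.2
  have hp'h : ∀ y ∈ S, p'.toFun (h y) = i.toFun y := fun y hy => p'.apply_inv hy.2
  obtain ⟨γ, hγ⟩ := (A.chart b).mem_closure_interior_eq_act hSo (f := j.toFun) (g := q.toFun ∘ h)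
    (j.smooth.continuousOn.mono Set.inter_subset_left)
    (q.smooth.continuousOn.comp hhs.continuousOn hhU) (fun y hy => j.mapsTo hy.1)
    (fun y hy => q.mapsTo (hhU hy))
    (fun y hy => by
      rw [j.comm y hy.1, Function.comp_apply, q.comm _ (hhU hy), ← p'.comm _ (hhU hy), hp'h y hy,
        i.comm y hy.1]) hxS
  have hloc : ∀ y ∈ interior {y ∈ S | j.toFun y = (A.chart b).act γ ((q.toFun ∘ h) y)},
      formPullback i.toFun (Ω.form a) y = formPullback j.toFun (Ω.form b) y := by
    intro y hy
    have hyS : y ∈ S := (interior_subset hy).1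
    set q' := (Embedding.ofAct (A.chart b) γ).comp q
    have hd : DifferentiableAt ℝ h y :=
      (hhs.contDiffAt (hSo.mem_nhds hyS)).differentiableAt (by simp)
    have h1 : i.toFun =ᶠ[𝓝 y] p'.toFun ∘ h := by
      filter_upwards [hSo.mem_nhds hyS] with z hz using (hp'h z hz).symm
    have h2 : j.toFun =ᶠ[𝓝 y] q'.toFun ∘ h := by
      filter_upwards [isOpen_interior.mem_nhds hy] with z hz using (interior_subset hz).2
    rw [formPullback_congr_map _ h1, formPullback_congr_map _ h2,
      formPullback_comp _ (p'.differentiableAt (hhU hyS)) hd,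
      formPullback_comp _ (q'.differentiableAt (hhU hyS)) hd]
    exact formPullback_congr_form (Ω.agree a b e p' q' _ (hhU hyS))
  have hcont : ∀ (a' : A.Index) (i' : d.Embedding (A.chart a')),
      ContinuousAt (formPullback i'.toFun (Ω.form a')) x := fun a' i' =>
    continuousAt_formPullback ((Ω.smooth a').continuousOn.continuousAt
      ((A.chart a').isOpen_U.mem_nhds (i'.mapsTo hx))) (i'.contDiffAt hx)
  by_contra hne
  obtain ⟨y, hy, hy1⟩ := ((mem_closure_iff_frequently.1 hγ).and_eventually
    (eventually_ne_of_continuousAt (hcont a i) (hcont b j) hne)).exists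
  exact hy1 (hloc y hy)

/-- In a chart embedded into a chart of the atlas, an orbifold form is expressed by the pullback of
its local expression. -/
theorem DiffForm.hasExpression_of_embedding (Ω : A.DiffForm k) {c : OrbifoldChart X m} {a : A.Index}
    (κ : c.Embedding (A.chart a))
    {η : EuclideanSpace ℝ (Fin m) → EuclideanSpace ℝ (Fin m) [⋀^Fin k]→L[ℝ] ℝ}
    (hη : ∀ x ∈ c.U, formPullback κ.toFun (Ω.form a) x = η x) : Ω.HasExpression c η := by
  intro b d i j x hx
  rw [← Ω.agree_of_embeddings (κ.comp i) j hx]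
  refine Eq.trans ?_ (formPullback_comp _ (κ.differentiableAt (i.mapsTo hx))
    (i.differentiableAt hx)).symm
  exact formPullback_congr_form (hη _ (i.mapsTo hx)).symm

end OrbifoldAtlas

/-! ### Darboux charts -/

namespace OrbifoldAtlas

open OrbifoldChart

/-- Around every point of a chart there is a parametrization in which the stabilizer acts linearly,
through its isotropy representation, and the symplectic form is constant. -/
theorem DiffForm.IsSymplectic.exists_darboux_parametrization {X : Type*} [TopologicalSpace X]
    {m : ℕ} {A : OrbifoldAtlas X m} {Ω : A.DiffForm 2} (hΩ : Ω.IsSymplectic) (a : A.Index)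
    {u : EuclideanSpace ℝ (Fin m)} (hu : u ∈ (A.chart a).U) :
    ∃ (e : OpenPartialHomeomorph (EuclideanSpace ℝ (Fin m)) (EuclideanSpace ℝ (Fin m)))
      (β : EuclideanSpace ℝ (Fin m) [⋀^Fin 2]→L[ℝ] ℝ),
      0 ∈ e.source ∧ e 0 = u ∧ e.target ⊆ (A.chart a).U ∧ ContDiffOn ℝ ∞ e e.source ∧
      ContDiffOn ℝ ∞ e.symm e.target ∧
      (∀ γ, ∀ᶠ x in 𝓝 0,
        e ((A.chart a).isotropyRep hu γ x) = (A.chart a).act γ (e x)) ∧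
      (∀ x ∈ e.source, formPullback e (Ω.form a) x = β) ∧
      (∀ γ, β.compContinuousLinearMap ((A.chart a).isotropyRep hu γ) = β) ∧
      ∀ v, v ≠ 0 → ∃ w, β ![v, w] ≠ 0 := by
  obtain ⟨f, h0, hf0, htgt, hsm, hsm', hL⟩ :=
    (A.chart a).exists_linearizing_parametrization hu isOpen_univ (Set.mem_univ u)
  replace htgt : f.target ⊆ (A.chart a).U := htgt.trans Set.inter_subset_left
  set L := (A.chart a).isotropyRep hu with hLdef
  set η := formPullback f (Ω.form a) with hη
  have hfU : Set.MapsTo f f.source (A.chart a).U := fun x hx => htgt (f.map_source hx)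
  have hfat : ∀ x ∈ f.source, ContDiffAt ℝ ∞ f x := fun x hx =>
    hsm.contDiffAt (f.open_source.mem_nhds hx)
  have hΩat : ∀ x ∈ (A.chart a).U, ContDiffAt ℝ ∞ (Ω.form a) x := fun x hx =>
    (Ω.smooth a).contDiffAt ((A.chart a).isOpen_U.mem_nhds hx)
  have hηs : ContDiffOn ℝ ∞ η f.source :=
    contDiffOn_formPullback_two f.open_source (Ω.smooth a) hsm hfU
  have hηcl : ∀ x ∈ f.source, extDeriv η x = 0 := fun x hx => by
    have h1 : extDeriv η x = (extDeriv (Ω.form a) (f x)).compContinuousLinearMap (fderiv ℝ f x) :=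
      extDeriv_pullback ((hΩat _ (hfU hx)).differentiableAt (by simp)) (hfat x hx)
        (by rw [minSmoothness_of_isRCLikeNormedField]; norm_cast)
    rw [h1, hΩ.closed a _ (hfU hx)]
    rfl
  -- The derivative of the parametrization at the origin is invertible.
  have hinv : (fderiv ℝ f.symm u).comp (fderiv ℝ f 0) = ContinuousLinearMap.id ℝ _ := by
    have h1 : f.symm ∘ f =ᶠ[𝓝 0] id := by
      filter_upwards [f.open_source.mem_nhds h0] with x hx using f.left_inv hx
    have h2 : DifferentiableAt ℝ f.symm (f 0) :=
      (hsm'.contDiffAt (f.open_target.mem_nhds (f.map_source h0))).differentiableAt (by simp)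
    rw [← hf0, ← fderiv_comp 0 h2 ((hfat 0 h0).differentiableAt (by simp)), h1.fderiv_eq, fderiv_id]
  have hinj : Function.Injective (fderiv ℝ f 0).toLinearMap :=
    Function.LeftInverse.injective (g := fderiv ℝ f.symm u) fun v => congrArg (fun T => T v) hinv
  have hηnd : ∀ v, v ≠ 0 → ∃ w, η 0 ![v, w] ≠ 0 := fun v hv => by
    obtain ⟨w, hw⟩ := hΩ.nondegenerate a (f 0) (hfU h0) (fderiv ℝ f 0 v)
      ((map_ne_zero_iff (fderiv ℝ f 0).toLinearMap hinj).2 hv)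
    obtain ⟨w, rfl⟩ := (LinearMap.injective_iff_surjective.1 hinj) w
    refine ⟨w, ?_⟩
    convert hw using 1
    change Ω.form a (f 0) _ = _
    congr 1
    ext1 i
    fin_cases i <;> rfl
  have hLsurj : ∀ γ, Function.Surjective (L γ) := fun γ v => ⟨L γ⁻¹ v, by
    have h1 : L γ * L γ⁻¹ = 1 := by rw [← map_mul, mul_inv_cancel, map_one]
    exact congrArg (fun T => T v) h1⟩
  have hηL : ∀ γ, ∀ᶠ x in 𝓝 0, (η (L γ x)).compContinuousLinearMap (L γ) = η x := fun γ => by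
    have hLc : Filter.Tendsto (L γ) (𝓝 0) (𝓝 0) := (L γ).continuous.tendsto' _ _ (map_zero _)
    filter_upwards [eventually_eventually_nhds.2 (hL γ), f.open_source.mem_nhds h0,
      hLc (f.open_source.mem_nhds h0)] with x h1 h2 h3
    have h4 : f ∘ L γ =ᶠ[𝓝 x] (A.chart a).act γ ∘ f := h1
    have h5 : formPullback (L γ) η x = (η (L γ x)).compContinuousLinearMap (L γ) := by
      rw [formPullback, ContinuousLinearMap.fderiv]
    rw [← h5, hη, ← formPullback_comp _ ((hfat _ h3).differentiableAt (by simp))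
      (L γ).differentiableAt, formPullback_congr_map _ h4,
      formPullback_comp _ ((A.chart a).act_hasFDerivAt _ (hfU h2)).differentiableAt
        ((hfat x h2).differentiableAt (by simp))]
    exact formPullback_congr_form (Ω.invariant a γ _ (hfU h2))
  obtain ⟨g, hg0, hg00, hgt, hgs, hgs', hgη, hgL⟩ :=
    exists_equivariant_darboux f.open_source h0 hηs hηcl hηnd
  have hsub : ∀ x ∈ (g.trans f).source, x ∈ g.source ∧ g x ∈ f.source := fun x hx => hx
  have hsub' : ∀ x ∈ (g.trans f).target, x ∈ f.target ∧ f.symm x ∈ g.target := fun x hx => hx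
  refine ⟨g.trans f, η 0, ⟨hg0, ?_⟩, ?_, fun x hx => htgt (hsub' x hx).1, ?_, ?_, fun γ => ?_,
    fun x hx => ?_, fun γ => ?_, hηnd⟩
  · change g 0 ∈ f.source
    rwa [hg00]
  · rw [OpenPartialHomeomorph.coe_trans, Function.comp_apply, hg00, hf0]
  · exact hsm.comp (hgs.mono fun x hx => (hsub x hx).1) fun x hx => (hsub x hx).2
  · exact hgs'.comp (hsm'.mono fun x hx => (hsub' x hx).1) fun x hx => (hsub' x hx).2
  · have hgc : Filter.Tendsto g (𝓝 0) (𝓝 0) := by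
      have := (g.continuousAt hg0).tendsto
      rwa [hg00] at this
    filter_upwards [hgL (L γ) (hLsurj γ) (hηL γ), hgc.eventually (hL γ)] with x h1 h2
    rw [OpenPartialHomeomorph.coe_trans, Function.comp_apply, h1, h2, Function.comp_apply]
  · rw [OpenPartialHomeomorph.coe_trans,
      formPullback_comp _ ((hfat _ (hsub x hx).2).differentiableAt (by simp))
        ((hgs.contDiffAt (g.open_source.mem_nhds (hsub x hx).1)).differentiableAt (by simp))]
    exact hgη x (hsub x hx).1
  · have h1 := (hηL γ).self_of_nhds
    rwa [map_zero] at h1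

end OrbifoldAtlas

/-- The complex coordinates on `ℝ²ⁿ` as a real linear equivalence. -/
noncomputable def complexCoordsEquiv (n : ℕ) :
    EuclideanSpace ℝ (Fin (2 * n)) ≃ₗ[ℝ] (Fin n → ℂ) :=
  LinearMap.linearEquivOfInjective
    { toFun := complexCoords
      map_add' := fun v w => by
        ext i
        apply Complex.ext <;> rfl
      map_smul' := fun t v => by
        ext i
        apply Complex.ext <;> simp [complexCoords] }
    (by
      intro v w h
      ext j
      have h1 := congrFun h (⟨j / 2, by omega⟩ : Fin n)
      rcases Nat.mod_two_eq_zero_or_one j with hj | hj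
      · have hj' : j = xIndex ⟨j / 2, by omega⟩ := Fin.ext (by simp only [xIndex]; omega)
        rw [hj']
        exact congrArg Complex.re h1
      · have hj' : j = yIndex ⟨j / 2, by omega⟩ := Fin.ext (by simp only [yIndex]; omega)
        rw [hj']
        exact congrArg Complex.im h1)
    (by simp [Module.finrank_pi_fintype, mul_comm])

theorem mainTheorem6 {X : Type*} [TopologicalSpace X] [T2Space X] [SecondCountableTopology X]
    (n : ℕ) (A : OrbifoldAtlas X (2 * n)) (Ω : A.DiffForm 2) (hΩ : Ω.IsSymplectic) (x₀ : X) :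
    ∃ c : OrbifoldChart X (2 * n), A.IsOrbifoldChart c ∧ 0 ∈ c.U ∧ c.φ 0 = x₀ ∧
      Ω.HasExpression c (fun _ => stdSymplecticForm n) ∧ c.IsUnitary := by
  obtain ⟨a, u, hu, hux⟩ := A.cover x₀
  obtain ⟨f, β, h0, hf0, htgt, hsm, hsm', hL, hfβ, hβL, hβ⟩ :=
    hΩ.exists_darboux_parametrization a hu
  set L := (A.chart a).isotropyRep hu with hLdef
  have hpair : ∀ (S : EuclideanSpace ℝ (Fin (2 * n)) →L[ℝ] EuclideanSpace ℝ (Fin (2 * n)))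
      (v : Fin 2 → EuclideanSpace ℝ (Fin (2 * n))),
      β.compContinuousLinearMap S v = β ![S (v 0), S (v 1)] := fun S v => by
    rw [ContinuousAlternatingMap.compContinuousLinearMap_apply]
    congr 1
    ext1 i
    fin_cases i <;> rfl
  let B : EuclideanSpace ℝ (Fin (2 * n)) →ₗ[ℝ] EuclideanSpace ℝ (Fin (2 * n)) →ₗ[ℝ] ℝ :=
    ContinuousLinearMap.toLinearMap₁₂ (alternatingToBilinear _ β)
  have hB : ∀ v w, B v w = β ![v, w] := fun v w => alternatingToBilinear_apply β v w
  obtain ⟨T, hT, s, hs, hTs⟩ := exists_unitary_coordinates (n := n) (by simp)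
    ((ContinuousLinearMap.toLinearMapRingHom (R₁ := ℝ)
      (M₁ := EuclideanSpace ℝ (Fin (2 * n)))).toMonoidHom.comp L)
    (fun γ δ h => (A.chart a).isotropyRep_injective hu
      (ContinuousLinearMap.coe_injective h)) B
    (fun v => by
      rw [hB]
      exact β.map_eq_zero_of_eq _ (i := 0) (j := 1) rfl (by simp))
    (fun v hv => by simpa only [hB] using hβ v hv)
    (fun γ v w => by
      rw [hB, hB]
      exact (hpair (L γ) ![v, w]).symm.trans (by rw [hβL γ]))
  -- The change from standard to unitary coordinates, and the group in the standard coordinates.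
  let τ : EuclideanSpace ℝ (Fin (2 * n)) ≃L[ℝ] EuclideanSpace ℝ (Fin (2 * n)) :=
    ((complexCoordsEquiv n).trans T).toContinuousLinearEquiv
  have hτ : ∀ x, τ x = T (complexCoords x) := fun x => rfl
  have hτs : ∀ x, complexCoords (τ.symm x) = T.symm x := fun x => by
    rw [LinearEquiv.eq_symm_apply, ← hτ, τ.apply_symm_apply]
  let e := τ.toHomeomorph.toOpenPartialHomeomorph.trans f
  have he : ⇑e = f ∘ τ := rfl
  have hes : ∀ x, x ∈ e.source ↔ τ x ∈ f.source := fun x => by simp [e]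
  have het : e.target ⊆ f.target := fun x hx => hx.1
  have h0e : 0 ∈ e.source := by rwa [hes, map_zero]
  have he0 : e 0 = u := by rw [he, Function.comp_apply, map_zero, hf0]
  let L' : (A.chart a).stabilizer hu →*
      (EuclideanSpace ℝ (Fin (2 * n)) →L[ℝ] EuclideanSpace ℝ (Fin (2 * n))) :=
    { toFun := fun γ => (τ.symm : _ →L[ℝ] _).comp ((L γ).comp (τ : _ →L[ℝ] _))
      map_one' := by
        ext1 x
        simp
      map_mul' := fun γ δ => by
        ext1 x
        simp }
  have hL'τ : ∀ γ x, τ (L' γ x) = L γ (τ x) := fun γ x => τ.apply_symm_apply _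
  obtain ⟨c, k, r, hr, h0c, -, hce, hk, hact, -⟩ :=
    (A.chart a).exists_chart_of_parametrization hu e h0e he0 (het.trans htgt)
      (hsm.comp τ.contDiff.contDiffOn fun x hx => (hes x).1 hx)
      (τ.symm.contDiff.comp_contDiffOn (hsm'.mono het)) L'
      (fun γ => by
        have hτc : Filter.Tendsto τ (𝓝 0) (𝓝 0) := τ.continuous.tendsto' _ _ (map_zero τ)
        filter_upwards [hτc.eventually (hL γ)] with x hx
        rw [he, Function.comp_apply, hL'τ, hx, Function.comp_apply])
      Filter.univ_mem
  refine ⟨c, A.isOrbifoldChart_of_embedding k, h0c, ?_, Ω.hasExpression_of_embedding k ?_, ?_⟩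
  · rw [← k.comm 0 h0c, hk, he0, hux]
  · intro x hx
    have hx' : τ x ∈ f.source := (hes x).1 (hce hx)
    rw [hk, he, formPullback_comp _
      ((hsm.contDiffAt (f.open_source.mem_nhds hx')).differentiableAt (by simp))
      τ.differentiableAt, formPullback, hfβ _ hx', ContinuousLinearEquiv.fderiv]
    ext v
    rw [hpair, ← hB]
    exact hT _ _
  · refine ⟨s.comp r, hs.comp hr, fun γ x _ => ?_⟩
    rw [hact]
    refine (hτs _).trans ?_
    rw [LinearEquiv.symm_apply_eq]
    exact hTs (r γ) (complexCoords x)
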